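/- Let $\mathcal X,\mathcal Z$ be finite alphabets, $P_X$ a probability distribution on $\mathcal X$ and $P_{Z|X}$ a channel (the wiretapper's discrete memoryless channel). Logarithms are natural. For a channel $Q=Q_{Z|X}$ let $I_Q(X;Z)$ be the mutual information under $P_X\times Q_{Z|X}$, and let $$D(Q\|P_{Z|X}|P_X)=\sum_x P_X(x)\sum_z Q(z|x)\ln\frac{Q(z|x)}{P_{Z|X}(z|x)}\in[0,+\infty].$$ A minimum over an empty set is $+\infty$. Put $$E_3(R_1)=\min_{Q}\{D(Q\|P_{Z|X}|P_X):\ I_Q(X;Z)\ge R_1\}.$$ *Ensemble and exponent.* Given a block length $n$, a type $\hat P_n$ of denominator $n$ and positive integers $M,M_2$, draw $M M_2$ codewords independently and uniformly from the type class of $\hat P_n$, and split them into sub-codes $\mathcal C_0,\dots,\mathcal C_{M-1}$ of size $M_2$. The message $w$ is uniform on $\{0,\dots,M-1\}$, the transmitted word is uniform in $\mathcal C_w$, and it is sent through $n$ memoryless uses of $P_{Z|X}$. The wiretapper uses the optimum decoder $\hat w(\mathbf z)=\arg\max_w P(\mathbf z|\mathcal C_w)$, where $P(\mathbf z|\mathcal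 C_w)=\frac1{M_2}\sum_{\mathbf x\in\mathcal C_w}P(\mathbf z|\mathbf x)$ (the sum runs over the $M_2$ codewords, with multiplicity). Let $\overline{P_c}$ be the probability that $\hat w(\mathbf Z)=w$, averaged over the ensemble. For $0\le R_2\le R_1$ define $$E(R_1,R_2)=\lim\Big[-\frac1n\ln\overline{P_c}\Big]$$ as $n\to\infty$, $\hat P_n\to P_X$, $\frac1n\ln M\to R_1-R_2$ and $\frac1n\ln M_2\to R_2$. Then: 1. For all $0\le R_2\le R_1$ the limit $E(R_1,R_2)$ exists, and $E(R_1,R_2)=R_1-R_2$ (the scheme is as secure as blind guessing of the message) if and only if $$R_2\ge R_1-E_3(R_1)\quad\text{and}\quad \min_{Q}\{D(Q\|P_{Z|X}|P_X)-I_Q(X;Z):\ R_2\le I_Q(X;Z)\le R_1\}\ge -R_2.$$ 2. There are rates $0\le R_2<R_1$ with $E(R_1,R_2)=R_1-R_2>0$. 3. The function $Q\mapsto D(Q\|P_{Z|X}|P_X)-I_Q(X;Z)$ attains its minimum over all channels $Q$. Let $Q^*$ be any minimizer and let $R_1>I_{Q^*}(X;Z)$. Then $$\max\{I_{Q^*}(X;Z)-D(Q^*\|P_{Z|X}|P_X),\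 R_1-E_3(R_1)\}\le I_{Q^*}(X;Z),$$ and every $R_2$ with $$\max\{I_{Q^*}(X;Z)-D(Q^*\|P_{Z|X}|P_X),\ R_1-E_3(R_1)\}\le R_2\le I_{Q^*}(X;Z)$$ satisfies $0\le R_2<R_1$ and $E(R_1,R_2)=R_1-R_2>0$. -/

import Mathlib

open Filter Topology

noncomputable section

namespace Wiretap

/-- A discrete memoryless channel (transition matrix) with finite alphabets: each row is a
probability vector. -/
def IsChannel {X Z : Type*} [Fintype Z] (Q : X → Z → ℝ) : Prop :=
  ∀ x, Q x ∈ stdSimplex ℝ Z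

/-- The output marginal of the joint law `P x * Q x z`. -/
def outputLaw {X Z : Type*} [Fintype X] (P : X → ℝ) (Q : X → Z → ℝ) (z : Z) : ℝ :=
  ∑ x, P x * Q x z

/-- Mutual information `I_Q(X;Z)` in nats, under `Q_{XZ} = P × Q`. -/
def mutualInfo {X Z : Type*} [Fintype X] [Fintype Z] (P : X → ℝ) (Q : X → Z → ℝ) : ℝ :=
  ∑ x, P x * ∑ z, Q x z * Real.log (Q x z / outputLaw P Q z)

open Classical in
/-- Weighted divergence `D(Q‖W|P)` in nats. It is `+∞` as soon as, for some `x` with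
`P x ≠ 0`, the row `Q x` is not absolutely continuous with respect to `W x`. -/
def condDiv {X Z : Type*} [Fintype X] [Fintype Z] (P : X → ℝ) (Q W : X → Z → ℝ) : EReal :=
  if ∀ x z, P x ≠ 0 → W x z = 0 → Q x z = 0 then
    ((∑ x, P x * ∑ z, Q x z * Real.log (Q x z / W x z) : ℝ) : EReal)
  else ⊤

/-- `D(Q‖W|P) - I_Q(X;Z)`. -/
def divSubInfo {X Z : Type*} [Fintype X] [Fintype Z] (P : X → ℝ) (W Q : X → Z → ℝ) : EReal :=
  condDiv P Q W - (mutualInfo P Q : EReal)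

/-- `E₃(R₁) = min {D(Q‖W|P) : I_Q(X;Z) ≥ R₁}`, equal to `+∞` if no `Q` is feasible. -/
def E3 {X Z : Type*} [Fintype X] [Fintype Z] (P : X → ℝ) (W : X → Z → ℝ) (R₁ : ℝ) : EReal :=
  ⨅ (Q : X → Z → ℝ) (_ : IsChannel Q ∧ R₁ ≤ mutualInfo P Q), condDiv P Q W

/-- `min {D(Q‖W|P) - I_Q(X;Z) : R₂ ≤ I_Q(X;Z) ≤ R₁}`, equal to `+∞` if no `Q` is feasible. -/
def minDivSubInfo {X Z : Type*} [Fintype X] [Fintype Z] (P : X → ℝ) (W : X → Z → ℝ)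
    (R₁ R₂ : ℝ) : EReal :=
  ⨅ (Q : X → Z → ℝ) (_ : IsChannel Q ∧ R₂ ≤ mutualInfo P Q ∧ mutualInfo P Q ≤ R₁),
    divSubInfo P W Q

/-- `Q` is an unconstrained minimizer of `D(·‖W|P) - I(X;Z)` over all channels. -/
def IsUnconstrainedMinimizer {X Z : Type*} [Fintype X] [Fintype Z] (P : X → ℝ)
    (W Q : X → Z → ℝ) : Prop :=
  IsChannel Q ∧ ∀ Q' : X → Z → ℝ, IsChannel Q' → divSubInfo P W Q ≤ divSubInfo P W Q'

/-- Words of length `n` in which each letter `a` occurs exactly `c a` times. -/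
def typeClass {X : Type*} [Fintype X] [DecidableEq X] (n : ℕ) (c : X → ℕ) :
    Finset (Fin n → X) :=
  Finset.univ.filter fun x => ∀ a, (Finset.univ.filter fun i => x i = a).card = c a

/-- A code of `M` sub-codes, each made of `M₂` words of length `n`; `C w b` is the word sent
for the message `w` and the randomization index `b`. -/
abbrev Code (X : Type*) (n M M₂ : ℕ) := Fin M → Fin M₂ → Fin n → X

/-- The probability that the memoryless channel `W` maps the word `x` to the word `z`. -/
def wordProb {X Z : Type*} (W : X → Z → ℝ) {n : ℕ} (x : Fin n → X) (z : Fin n → Z) : ℝ :=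
  ∏ i, W (x i) (z i)

/-- `P(z | C_w)`: the law of the output when the message is `w` and the transmitted word is
uniform in the sub-code `C_w`. -/
def subcodeProb {X Z : Type*} (W : X → Z → ℝ) {n M M₂ : ℕ} (C : Code X n M M₂) (w : Fin M)
    (z : Fin n → Z) : ℝ :=
  (1 / (M₂ : ℝ)) * ∑ b, wordProb W (C w b) z

/-- The optimum decoder `ŵ(z) = argmax_w P(z | C_w)`. -/
def optDecoder {X Z : Type*} (W : X → Z → ℝ) {n M M₂ : ℕ} [NeZero M] (C : Code X n M M₂)
    (z : Fin n → Z) : Fin M :=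
  (Finite.exists_max fun w => subcodeProb W C w z).choose

/-- Probability of correct decoding `(1/M) ∑_w Pr{ŵ(Z) = w | W = w}` of the optimum decoder. -/
def correctProb {X Z : Type*} [Fintype Z] (W : X → Z → ℝ) {n M M₂ : ℕ} [NeZero M]
    (C : Code X n M M₂) : ℝ :=
  (1 / (M : ℝ)) *
    ∑ w, ∑ z ∈ Finset.univ.filter (fun z : Fin n → Z => optDecoder W C z = w),
      subcodeProb W C w z

/-- The parameters of a code ensemble: block length `n`, letter counts `c` (a type of
denominator `n`), number `M` of messages, and size `M₂` of each sub-code. -/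
structure EnsembleParams (X : Type*) [Fintype X] where
  n : ℕ
  c : X → ℕ
  sum_c : ∑ a, c a = n
  M : ℕ+
  M₂ : ℕ+

/-- Average probability of correct decoding when the `M * M₂` codewords are drawn independently
and uniformly from the type class of `c`: the average of `correctProb` over all codebooks with
words in that type class. -/
def avgCorrectProb {X Z : Type*} [Fintype X] [DecidableEq X] [Fintype Z]
    (W : X → Z → ℝ) (e : EnsembleParams X) : ℝ :=
  (∑ C : Fin e.M → Fin e.M₂ → typeClass e.n e.c,
      correctProb W (fun w b => (C w b : Fin e.n → X))) /
    (Fintype.card (Fin e.M → Fin e.M₂ → typeClass e.n e.c) : ℝ)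

/-- The asymptotic regime `n → ∞`, with composition `c / n → P`, `M = e^{n(R₁ - R₂) + o(n)}` and
`M₂ = e^{n R₂ + o(n)}`. -/
def regime {X : Type*} [Fintype X] (P : X → ℝ) (R₁ R₂ : ℝ) : Filter (EnsembleParams X) :=
  comap (fun e => e.n) atTop ⊓
  comap (fun e a => (e.c a : ℝ) / e.n) (𝓝 P) ⊓
  comap (fun e => Real.log (e.M : ℕ) / e.n) (𝓝 (R₁ - R₂)) ⊓
  comap (fun e => Real.log (e.M₂ : ℕ) / e.n) (𝓝 R₂)

/-- `-(1/n) ln` of the average probability of correct decoding. -/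
def normalizedExponent {X Z : Type*} [Fintype X] [DecidableEq X] [Fintype Z]
    (W : X → Z → ℝ) (e : EnsembleParams X) : ℝ :=
  -(Real.log (avgCorrectProb W e) / e.n)

/-- The correct-decoding exponent `E(R₁, R₂)` of the ensemble: the limit of
`-(1/n) ln` of the average probability of correct decoding. -/
def exponent {X Z : Type*} [Fintype X] [DecidableEq X] [Fintype Z]
    (P : X → ℝ) (W : X → Z → ℝ) (R₁ R₂ : ℝ) : ℝ :=
  limUnder (regime P R₁ R₂) (normalizedExponent W)

end Wiretap

end

/-! The proof is the method of types applied to the exact identity: probability of correct decoding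
= `(1/M) ∑_z max_w P(z|C_w)`. Sorting the words of `C_w` by their joint type `k` with `z` turns
`P(z|C_w)` into a sum of polynomially many terms, each a fixed weight times the number of words of
`C_w` of joint type `k` with `z`. Up to polynomial factors the maximum over `w` may thus be taken
for each `k` separately. The count is binomial with `M₂` trials and success probability `p ≈
e^{-nI}`, and the mean of its maximum over `M` independent sub-codes is `max (M₂ p) (min 1 (M M₂
p))`, up to a constant below and a factor `log M + 2` above (`codeAvg_maxHits_le_log`,
`div_le_codeAvg_maxHits`). With the type-class factor `e^{-nD}`, a joint type contributes `e^{-n(D +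
[R₁ - max(I, R₂)]₊)}`.

Hence `E(R₁, R₂)` is the minimum over `Q` of `D + [R₁ - max(I, R₂)]₊`
(`tendsto_normalizedExponent`). The functionals are written with entropies of the joint law, so they
are continuous up to the boundary, and the minimum over a compact set of channels is continuous in
the input law and the rates.

The choice `Q = W` has `D = 0` and gives `E ≤ R₁ - R₂`. Equality says that every `Q` has value at
least `R₁ - R₂`: for `I ≥ R₁` this is the condition on `E₃`, for `R₂ ≤ I ≤ R₁` the condition on `D -
I`, and for `I ≤ R₂` it is `D ≥ 0` (`exponentValue_eq_sub_iff`). An unconstrained minimizer of `D -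
I` controls both conditions, which yields the explicit pairs. -/

noncomputable section

set_option linter.unusedSectionVars false

namespace Wiretap

/-! ### Type classes and their cardinality -/

section Types

variable {A : Type*} [Fintype A] [DecidableEq A]

theorem mem_typeClass {n : ℕ} {c : A → ℕ} {x : Fin n → A} :
    x ∈ typeClass n c ↔ ∀ a, (Finset.univ.filter fun i => x i = a).card = c a := by
  simp [typeClass]

theorem typeClass_nonempty {n : ℕ} {c : A → ℕ} (h : ∑ a, c a = n) :
    (typeClass n c).Nonempty := by
  have hc : Fintype.card (Fin n) = Fintype.card (Σ a, Fin (c a)) := by simp [h]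
  let e := Fintype.equivOfCardEq hc
  refine ⟨fun i => (e i).1, mem_typeClass.2 fun a => ?_⟩
  have h1 : Fintype.card (Fin (c a)) = Fintype.card {i : Fin n // (e i).1 = a} := by
    refine Fintype.card_congr ?_
    exact ((e.subtypeEquiv (p := fun i => (e i).1 = a) (q := fun s => s.1 = a)
      (fun _ => Iff.rfl)).trans (Equiv.sigmaSubtype a)).symm
  rw [Fintype.card_fin, Fintype.card_subtype] at h1
  exact h1.symm

theorem comp_perm_mem_typeClass {n : ℕ} {c : A → ℕ} {x : Fin n → A} (σ : Equiv.Perm (Fin n)) :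
    x ∘ σ ∈ typeClass n c ↔ x ∈ typeClass n c := by
  simp only [mem_typeClass]
  refine forall_congr' fun a => ?_
  have : (Finset.univ.filter fun i => (x ∘ σ) i = a).card
      = (Finset.univ.filter fun i => x i = a).card :=
    Finset.card_equiv σ (by simp)
  rw [this]

theorem exists_perm_of_mem_typeClass {n : ℕ} {c : A → ℕ} {x y : Fin n → A}
    (hx : x ∈ typeClass n c) (hy : y ∈ typeClass n c) :
    ∃ σ : Equiv.Perm (Fin n), y ∘ σ = x := by
  have h : ∀ a, Nonempty ({i // x i = a} ≃ {i // y i = a}) := fun a => by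
    refine ⟨Fintype.equivOfCardEq ?_⟩
    rw [Fintype.card_subtype, Fintype.card_subtype, mem_typeClass.1 hx, mem_typeClass.1 hy]
  refine ⟨Equiv.ofFiberEquiv fun a => (h a).some, funext fun i => ?_⟩
  exact Equiv.ofFiberEquiv_map _ i

/-- Orbit-stabilizer for permutations of the positions: the type class is a single orbit, and the
stabilizer of a word permutes positions within each letter's fibre. -/
theorem card_typeClass_mul_prod_factorial {n : ℕ} {c : A → ℕ} (h : ∑ a, c a = n) :
    (typeClass n c).card * ∏ a, (c a).factorial = n.factorial := by
  classical
  obtain ⟨x, hx⟩ := typeClass_nonempty h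
  have : Fintype (Equiv.Perm (Fin n))ᵈᵐᵃ := Fintype.ofEquiv _ DomMulAct.mk
  have h1 := MulAction.card_orbit_mul_card_stabilizer_eq_card_group
    (Equiv.Perm (Fin n))ᵈᵐᵃ x
  have h2 : Fintype.card (MulAction.stabilizer (Equiv.Perm (Fin n))ᵈᵐᵃ x)
      = ∏ a, (c a).factorial := by
    have := DomMulAct.stabilizer_card x
    have h3 : Fintype.card {g : Equiv.Perm (Fin n) // x ∘ g = x} =
        Fintype.card (MulAction.stabilizer (Equiv.Perm (Fin n))ᵈᵐᵃ x) := by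
      refine Fintype.card_congr (DomMulAct.mk.subtypeEquiv fun g => ?_)
      rw [DomMulAct.mem_stabilizer_iff]; rfl
    rw [← h3, this]
    refine Finset.prod_congr rfl fun a _ => ?_
    rw [Fintype.card_subtype, mem_typeClass.1 hx]
  have h4 : Fintype.card (MulAction.orbit (Equiv.Perm (Fin n))ᵈᵐᵃ x) = (typeClass n c).card := by
    rw [← Fintype.card_coe]
    refine Fintype.card_congr (Equiv.subtypeEquivRight (q := fun y => y ∈ typeClass n c)
      fun y => ?_)
    constructor
    · rintro ⟨g, rfl⟩
      exact (comp_perm_mem_typeClass (DomMulAct.mk.symm g)).2 hx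
    · intro hy
      obtain ⟨σ, hσ⟩ := exists_perm_of_mem_typeClass hy hx
      exact ⟨DomMulAct.mk σ, hσ⟩
  rw [h2, h4] at h1
  rw [h1, ← Fintype.card_congr DomMulAct.mk, Fintype.card_perm, Fintype.card_fin]

end Types

/-! ### Factorial bounds and the entropy estimate of a type class -/

/-- Logarithmic error in the factorial estimate. -/
def factorialError (n : ℕ) : ℝ := 2 * Real.log (n + 1) + 1

theorem factorialError_mono {m n : ℕ} (h : m ≤ n) : factorialError m ≤ factorialError n := by
  unfold factorialError
  have : Real.log (m + 1) ≤ Real.log (n + 1) := Real.log_le_log (by positivity) (by gcongr)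
  linarith

theorem factorialError_nonneg (n : ℕ) : 0 ≤ factorialError n := by
  unfold factorialError
  have : 0 ≤ Real.log ((n : ℝ) + 1) := Real.log_nonneg (by linarith [n.cast_nonneg (α := ℝ)])
  linarith

theorem le_log_factorial (m : ℕ) :
    m * Real.log m - m ≤ Real.log m.factorial := by
  rcases Nat.eq_zero_or_pos m with rfl | hm
  · simp
  have h := Real.pow_div_factorial_le_exp (m : ℝ) (by positivity) m
  have hm' : (0 : ℝ) < m := by exact_mod_cast hm
  have hf : (0 : ℝ) < m.factorial := by exact_mod_cast m.factorial_pos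
  have := Real.log_le_log (by positivity) h
  rw [Real.log_exp, Real.log_div (by positivity) hf.ne', Real.log_pow] at this
  linarith

theorem one_sub_inv_le_log_div {s t : ℝ} (hs : 0 < s) (ht : 0 < t) :
    1 - s / t ≤ Real.log t - Real.log s := by
  have := Real.one_sub_inv_le_log_of_pos (div_pos ht hs)
  rwa [inv_div, Real.log_div ht.ne' hs.ne'] at this

theorem log_factorial_le (m : ℕ) :
    Real.log m.factorial ≤ m * Real.log m - m + factorialError m := by
  induction m with
  | zero => simp [factorialError]
  | succ m ih =>
    unfold factorialError at *
    have hf : (m.factorial : ℝ) ≠ 0 := by exact_mod_cast m.factorial_ne_zero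
    have hm : (0 : ℝ) ≤ m := m.cast_nonneg
    rw [Nat.factorial_succ]
    push_cast
    rw [Real.log_mul (by positivity) hf]
    have h1 : (m : ℝ) / (m + 1) ≤ m * (Real.log (m + 1) - Real.log m) := by
      rcases hm.eq_or_lt with h0 | h0
      · rw [← h0]; simp
      · have := one_sub_inv_le_log_div h0 (by positivity : (0 : ℝ) < m + 1)
        calc (m : ℝ) / (m + 1) = m * (1 - m / (m + 1)) := by field_simp; ring
          _ ≤ _ := by gcongr
    have h2 := one_sub_inv_le_log_div (by positivity : (0 : ℝ) < m + 1)
      (by positivity : (0 : ℝ) < m + 1 + 1)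
    -- This is the increment the induction must absorb. The coefficient `2` in `factorialError`
    -- makes `2/(m+2) ≥ 1/(m+1)` hold from `m = 0` on.
    have h3 : 1 ≤ (m : ℝ) / (m + 1) + 2 * (1 - (m + 1) / (m + 1 + 1)) := by
      rw [← sub_nonneg]
      have : (m : ℝ) / (m + 1) + 2 * (1 - (m + 1) / (m + 1 + 1)) - 1
        = m / ((m + 1) * (m + 1 + 1)) := by field_simp; ring
      rw [this]; positivity
    linarith

/-- The multinomial coefficient costs one factorial error for `n!` and one for each letter; the
linear terms of the factorial bounds cancel because the counts sum to `n`. -/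
theorem abs_log_card_typeClass_sub_le {A : Type*} [Fintype A] [DecidableEq A] {n : ℕ}
    (hn : 0 < n) {c : A → ℕ} (h : ∑ a, c a = n) :
    |Real.log (typeClass n c).card - n * ∑ a, Real.negMulLog (c a / n)|
      ≤ (Fintype.card A + 1) * factorialError n := by
  have hcard := card_typeClass_mul_prod_factorial h
  have hpos : 0 < (typeClass n c).card := (typeClass_nonempty h).card_pos
  have hlog : Real.log (typeClass n c).card
      = Real.log n.factorial - ∑ a, Real.log (c a).factorial := by
    rw [← hcard]
    push_cast
    rw [Real.log_mul (by exact_mod_cast hpos.ne')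
      (Finset.prod_ne_zero_iff.2 fun a _ => by exact_mod_cast (c a).factorial_ne_zero),
      Real.log_prod fun a _ => by exact_mod_cast (c a).factorial_ne_zero]
    ring
  have hn' : (0 : ℝ) < n := by exact_mod_cast hn
  have hsum : ∑ a, (c a : ℝ) = n := by exact_mod_cast h
  have hent : n * ∑ a, Real.negMulLog (c a / n)
      = (n * Real.log n - n) - ∑ a, (c a * Real.log (c a) - c a) := by
    have h1 : ∀ a, n * Real.negMulLog (c a / n)
        = c a * Real.log n - c a * Real.log (c a) := fun a => by
      rcases Nat.eq_zero_or_pos (c a) with h0 | h0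
      · simp [h0]
      · have : (0 : ℝ) < c a := by exact_mod_cast h0
        rw [Real.negMulLog, Real.log_div this.ne' hn'.ne']
        field_simp; ring
    rw [Finset.mul_sum, Finset.sum_congr rfl fun a _ => h1 a, Finset.sum_sub_distrib,
      Finset.sum_sub_distrib, ← Finset.sum_mul, hsum]
    ring
  have hca : ∀ a, c a ≤ n := fun a => h ▸ Finset.single_le_sum (fun _ _ => Nat.zero_le _)
    (Finset.mem_univ a)
  have hlow : ∑ a, (c a * Real.log (c a) - c a) ≤ ∑ a, Real.log (c a).factorial :=
    Finset.sum_le_sum fun a _ => le_log_factorial _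
  have hup : ∑ a, Real.log (c a).factorial
      ≤ ∑ a, (c a * Real.log (c a) - c a) + Fintype.card A * factorialError n := by
    calc ∑ a, Real.log (c a).factorial
        ≤ ∑ a, ((c a * Real.log (c a) - c a) + factorialError n) :=
          Finset.sum_le_sum fun a _ =>
            (log_factorial_le _).trans (by gcongr; exact factorialError_mono (hca a))
      _ = _ := by rw [Finset.sum_add_distrib]; simp
  have h1 := le_log_factorial n
  have h2 := log_factorial_le n
  have h3 := factorialError_nonneg n
  have h4 : 0 ≤ (Fintype.card A : ℝ) * factorialError n := by positivity
  rw [hlog, hent, abs_le]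
  constructor <;> linarith

/-! ### Joint types and conditional type classes -/

/-- The letterwise pairing of two words. -/
def pairWord {X Z : Type*} {n : ℕ} (x : Fin n → X) (z : Fin n → Z) : Fin n → X × Z :=
  fun i => (x i, z i)

section Joint

variable {X Z : Type*} [Fintype X] [DecidableEq X] [Fintype Z] [DecidableEq Z]

theorem left_mem_typeClass {n : ℕ} {k : X × Z → ℕ} {x : Fin n → X} {z : Fin n → Z}
    (h : pairWord x z ∈ typeClass n k) : x ∈ typeClass n fun a => ∑ b, k (a, b) := by
  rw [mem_typeClass] at h ⊢
  intro a
  rw [Finset.card_eq_sum_card_fiberwise (f := z) (t := Finset.univ)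
    (fun _ _ => Finset.mem_coe.2 (Finset.mem_univ _))]
  refine Finset.sum_congr rfl fun b _ => ?_
  rw [← h (a, b), Finset.filter_filter]
  simp [pairWord]

theorem right_mem_typeClass {n : ℕ} {k : X × Z → ℕ} {x : Fin n → X} {z : Fin n → Z}
    (h : pairWord x z ∈ typeClass n k) : z ∈ typeClass n fun b => ∑ a, k (a, b) := by
  rw [mem_typeClass] at h ⊢
  intro b
  rw [Finset.card_eq_sum_card_fiberwise (f := x) (t := Finset.univ)
    (fun _ _ => Finset.mem_coe.2 (Finset.mem_univ _))]
  refine Finset.sum_congr rfl fun a _ => ?_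
  rw [← h (a, b), Finset.filter_filter]
  simp [pairWord, and_comm]

/-- The joint type class is fibred over the second word, and all fibres are equinumerous because a
permutation of positions carries any `z'` of the class to `z`. -/
theorem card_conditional_typeClass {n : ℕ} {k : X × Z → ℕ} {z : Fin n → Z}
    (hz : z ∈ typeClass n fun b => ∑ a, k (a, b)) :
    (typeClass n fun b => ∑ a, k (a, b)).card *
      (Finset.univ.filter fun x : Fin n → X => pairWord x z ∈ typeClass n k).card
      = (typeClass n k).card := by
  have hmap : ∀ y ∈ typeClass n k,
      (fun i => (y i).2) ∈ typeClass n fun b => ∑ a, k (a, b) := fun y hy =>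
    right_mem_typeClass (x := fun i => (y i).1) (z := fun i => (y i).2) hy
  rw [Finset.card_eq_sum_card_fiberwise (f := fun (y : Fin n → X × Z) i => (y i).2) hmap,
    ← smul_eq_mul, ← Finset.sum_const]
  refine Finset.sum_congr rfl fun z' hz' => ?_
  obtain ⟨σ, hσ⟩ := exists_perm_of_mem_typeClass hz' hz
  refine Finset.card_bij' (fun x _ => pairWord (x ∘ σ) z') (fun y _ => (fun i => (y i).1) ∘ σ.symm)
    ?_ ?_ ?_ ?_
  · intro x hx
    simp only [Finset.mem_filter, Finset.mem_univ, true_and] at hx ⊢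
    refine ⟨?_, rfl⟩
    rw [← hσ]
    exact (comp_perm_mem_typeClass σ).2 hx
  · intro y hy
    simp only [Finset.mem_filter, Finset.mem_univ, true_and] at hy ⊢
    rw [← comp_perm_mem_typeClass σ]
    convert hy.1 using 1
    funext i
    have := congrFun (hσ.trans hy.2.symm) i
    simp only [Function.comp_apply] at this
    simp [pairWord, this]
  · intro x _
    funext i
    simp [pairWord]
  · intro y hy
    simp only [Finset.mem_filter] at hy
    funext i
    have := congrFun hy.2 i
    simp [pairWord, ← this]

end Joint

/-! ### Random codebooks: the largest number of hits among the sub-codes -/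

section RandomCode

variable {T : Type*} [Fintype T] {M N : ℕ}

/-- Average over all codebooks with entries in `T`. -/
def codeAvg (F : (Fin M → Fin N → T) → ℝ) : ℝ :=
  (∑ C, F C) / (Fintype.card (Fin M → Fin N → T) : ℝ)

theorem codeAvg_mono {F G : (Fin M → Fin N → T) → ℝ} (h : ∀ C, F C ≤ G C) :
    codeAvg F ≤ codeAvg G := by
  unfold codeAvg
  gcongr with C
  exact h C

theorem codeAvg_add (F G : (Fin M → Fin N → T) → ℝ) :
    codeAvg (fun C => F C + G C) = codeAvg F + codeAvg G := by
  simp [codeAvg, Finset.sum_add_distrib, add_div]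

theorem codeAvg_mul_left (a : ℝ) (F : (Fin M → Fin N → T) → ℝ) :
    codeAvg (fun C => a * F C) = a * codeAvg F := by
  simp [codeAvg, ← Finset.mul_sum, mul_div_assoc]

theorem codeAvg_sum {ι : Type*} (s : Finset ι) (F : ι → (Fin M → Fin N → T) → ℝ) :
    codeAvg (fun C => ∑ i ∈ s, F i C) = ∑ i ∈ s, codeAvg (F i) := by
  unfold codeAvg
  rw [Finset.sum_comm, Finset.sum_div]

theorem codeAvg_const [Nonempty T] (a : ℝ) :
    codeAvg (fun _ : Fin M → Fin N → T => a) = a := by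
  have : (Fintype.card (Fin M → Fin N → T) : ℝ) ≠ 0 := by
    exact_mod_cast Fintype.card_ne_zero
  simp only [codeAvg, Finset.sum_const, Finset.card_univ, nsmul_eq_mul]
  field_simp

/-- Independence of the codewords. -/
theorem codeAvg_prod (f : Fin M → Fin N → T → ℝ) :
    codeAvg (fun C => ∏ w, ∏ b, f w b (C w b))
      = ∏ w, ∏ b, (∑ t, f w b t) / (Fintype.card T : ℝ) := by
  classical
  have h1 : ∑ C : Fin M → Fin N → T, ∏ w, ∏ b, f w b (C w b) = ∏ w, ∏ b, ∑ t, f w b t := by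
    have := Fintype.prod_sum (fun (w : Fin M) (D : Fin N → T) => ∏ b, f w b (D b))
    rw [← this]
    exact Finset.prod_congr rfl fun w _ => (Fintype.prod_sum _).symm
  unfold codeAvg
  rw [h1]
  simp [Finset.prod_div_distrib]

variable (A : Finset T) [DecidableEq T]

/-- The number of words of the sub-code `w` in the set `A`. -/
def hits (C : Fin M → Fin N → T) (w : Fin M) : ℝ := ∑ b, if C w b ∈ A then (1 : ℝ) else 0

theorem hits_nonneg (C : Fin M → Fin N → T) (w : Fin M) : 0 ≤ hits A C w :=
  Finset.sum_nonneg fun _ _ => by split_ifs <;> norm_num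

/-- The probability that a uniform word lies in `A`. -/
def density : ℝ := (A.card : ℝ) / (Fintype.card T : ℝ)

theorem density_nonneg : 0 ≤ density A := by unfold density; positivity

theorem density_le_one : density A ≤ 1 := by
  unfold density
  refine div_le_one_of_le₀ ?_ (by positivity)
  exact_mod_cast A.card_le_univ

theorem sum_affine_indicator [Nonempty T] (u v : ℝ) :
    (∑ t : T, (u + v * if t ∈ A then (1 : ℝ) else 0)) / (Fintype.card T : ℝ)
      = u + v * density A := by
  have : (Fintype.card T : ℝ) ≠ 0 := by exact_mod_cast Fintype.card_ne_zero
  rw [Finset.sum_add_distrib, ← Finset.mul_sum]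
  simp only [Finset.sum_const, Finset.card_univ, nsmul_eq_mul, Finset.sum_ite_mem,
    Finset.univ_inter, mul_one, density]
  field_simp

theorem codeAvg_hits [Nonempty T] (w : Fin M) :
    codeAvg (fun C : Fin M → Fin N → T => hits A C w) = N * density A := by
  have h : ∀ b : Fin N, codeAvg (fun C : Fin M → Fin N → T => if C w b ∈ A then (1 : ℝ) else 0)
      = density A := fun b => by
    -- The indicator of a single codeword is a product over all codewords with factor `1` elsewhere,
    -- so independence applies.
    have h1 := codeAvg_prod (M := M) (N := N) (T := T)
      (fun w' b' t => if w' = w ∧ b' = b then 0 + 1 * (if t ∈ A then (1 : ℝ) else 0) else 1)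
    have h2 : ∀ C : Fin M → Fin N → T, ∏ w', ∏ b', (if w' = w ∧ b' = b then
        0 + 1 * (if C w' b' ∈ A then (1 : ℝ) else 0) else 1) = if C w b ∈ A then 1 else 0 := by
      intro C
      rw [Finset.prod_eq_single w, Finset.prod_eq_single b] <;> simp +contextual
    simp only [h2] at h1
    rw [h1, Finset.prod_eq_single w, Finset.prod_eq_single b]
    · simp only [and_self, if_true]
      rw [sum_affine_indicator]; ring
    · intro b' _ hb; simp [hb]
    · simp
    · intro w' _ hw; simp [hw]
    · simp
  unfold hits
  rw [codeAvg_sum, Finset.sum_congr rfl fun b _ => h b]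
  simp

/-- The exponential moment factors into `(1 + (e - 1) p)^N`, and `e - 1 ≤ 2`. -/
theorem codeAvg_exp_hits_le [Nonempty T] (w : Fin M) :
    codeAvg (fun C : Fin M → Fin N → T => Real.exp (hits A C w))
      ≤ Real.exp (2 * (N * density A)) := by
  have h1 := codeAvg_prod (M := M) (N := N) (T := T)
    (fun w' _ t => if w' = w then 1 + (Real.exp 1 - 1) * (if t ∈ A then (1 : ℝ) else 0) else 1)
  have h2 : ∀ C : Fin M → Fin N → T, ∏ w', ∏ b', (if w' = w then
      1 + (Real.exp 1 - 1) * (if C w' b' ∈ A then (1 : ℝ) else 0) else 1)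
      = Real.exp (hits A C w) := by
    intro C
    rw [Finset.prod_eq_single w]
    · rw [hits, Real.exp_sum]
      refine Finset.prod_congr rfl fun b _ => ?_
      split_ifs <;> simp_all
    · intro w' _ hw; simp [hw]
    · simp
  simp only [h2] at h1
  rw [h1, Finset.prod_eq_single w]
  · simp only [if_true]
    rw [sum_affine_indicator]
    have hd := density_nonneg A
    have he : Real.exp 1 - 1 ≤ 2 := by linarith [Real.exp_one_lt_three]
    have he' : 0 ≤ Real.exp 1 - 1 := by linarith [Real.add_one_le_exp (1 : ℝ)]
    calc ∏ _b : Fin N, (1 + (Real.exp 1 - 1) * density A)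
        ≤ ∏ _b : Fin N, Real.exp (2 * density A) := by
          refine Finset.prod_le_prod (fun _ _ => by positivity) fun _ _ => ?_
          have := Real.add_one_le_exp (2 * density A)
          nlinarith
      _ = Real.exp (2 * (N * density A)) := by
          rw [Finset.prod_const, ← Real.exp_nat_mul]; simp; ring
  · intro w' _ hw
    have : (Fintype.card T : ℝ) ≠ 0 := by exact_mod_cast Fintype.card_ne_zero
    simp [hw, this]
  · simp

theorem codeAvg_no_hit [Nonempty T] :
    codeAvg (fun C : Fin M → Fin N → T => ∏ w, ∏ b, (1 - if C w b ∈ A then (1 : ℝ) else 0))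
      = (1 - density A) ^ (M * N) := by
  have h1 := codeAvg_prod (M := M) (N := N) (T := T)
    (fun _ _ t => 1 + (-1) * (if t ∈ A then (1 : ℝ) else 0))
  simp only [sum_affine_indicator] at h1
  simp only [sub_eq_add_neg, ← neg_one_mul (ite _ _ _)]
  rw [h1]
  simp [pow_mul']

/-- The largest number of words of a sub-code in `A`. -/
def maxHits [NeZero M] (C : Fin M → Fin N → T) : ℝ :=
  Finset.univ.sup' Finset.univ_nonempty (hits A C)

theorem hits_le_maxHits [NeZero M] (C : Fin M → Fin N → T) (w : Fin M) :
    hits A C w ≤ maxHits A C :=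
  Finset.le_sup' (hits A C) (Finset.mem_univ w)

theorem exists_hits_eq_maxHits [NeZero M] (C : Fin M → Fin N → T) :
    ∃ w, maxHits A C = hits A C w := by
  obtain ⟨w, -, h⟩ := Finset.exists_mem_eq_sup' (Finset.univ_nonempty) (hits A C)
  exact ⟨w, h⟩

theorem maxHits_nonneg [NeZero M] (C : Fin M → Fin N → T) : 0 ≤ maxHits A C :=
  (hits_nonneg A C 0).trans (hits_le_maxHits A C 0)

theorem codeAvg_maxHits_le_mul [NeZero M] [Nonempty T] :
    codeAvg (fun C : Fin M → Fin N → T => maxHits A C) ≤ M * N * density A := by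
  calc codeAvg (fun C : Fin M → Fin N → T => maxHits A C)
      ≤ codeAvg (fun C : Fin M → Fin N → T => ∑ w, hits A C w) := codeAvg_mono fun C => by
        obtain ⟨w, h⟩ := exists_hits_eq_maxHits A C
        rw [h]
        exact Finset.single_le_sum (fun w _ => hits_nonneg A C w) (Finset.mem_univ w)
    _ = M * N * density A := by
        rw [codeAvg_sum]
        simp [codeAvg_hits, mul_assoc]

/-- A maximal inequality without tail bounds: the tangent `x - L + 1 ≤ e^{x-L}` is applied to the
maximum, `e^{max}` is bounded by the sum of the `e^{hits}`, and `L` is chosen so that this sum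
averages to at most `e^L`. -/
theorem codeAvg_maxHits_le_log [NeZero M] [Nonempty T] :
    codeAvg (fun C : Fin M → Fin N → T => maxHits A C)
      ≤ Real.log M + 2 * (N * density A) := by
  have hM : (0 : ℝ) < M := by exact_mod_cast NeZero.pos M
  set L : ℝ := Real.log M + 2 * (N * density A) with hL
  have hexp : Real.exp L = M * Real.exp (2 * (N * density A)) := by
    rw [hL, Real.exp_add, Real.exp_log hM]
  have hpt : ∀ C : Fin M → Fin N → T,
      maxHits A C ≤ (L - 1) + (Real.exp L)⁻¹ * ∑ w, Real.exp (hits A C w) := fun C => by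
    obtain ⟨w, h⟩ := exists_hits_eq_maxHits A C
    have h1 : Real.exp (maxHits A C) ≤ ∑ w, Real.exp (hits A C w) := by
      rw [h]
      exact Finset.single_le_sum (f := fun w => Real.exp (hits A C w))
        (fun w _ => (Real.exp_pos _).le) (Finset.mem_univ w)
    have h2 := Real.add_one_le_exp (maxHits A C - L)
    rw [Real.exp_sub, div_eq_inv_mul] at h2
    have h3 : (Real.exp L)⁻¹ * Real.exp (maxHits A C)
        ≤ (Real.exp L)⁻¹ * ∑ w, Real.exp (hits A C w) := by gcongr
    linarith
  refine (codeAvg_mono hpt).trans ?_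
  rw [codeAvg_add, codeAvg_const, codeAvg_mul_left, codeAvg_sum]
  have h4 : ∑ w : Fin M, codeAvg (fun C : Fin M → Fin N → T => Real.exp (hits A C w))
      ≤ Real.exp L := by
    rw [hexp]
    refine (Finset.sum_le_sum fun w _ => codeAvg_exp_hits_le A w).trans ?_
    simp
  have h5 : (Real.exp L)⁻¹ * ∑ w : Fin M,
      codeAvg (fun C : Fin M → Fin N → T => Real.exp (hits A C w)) ≤ 1 := by
    rw [inv_mul_le_iff₀ (Real.exp_pos _)]; linarith
  linarith

theorem le_codeAvg_maxHits [NeZero M] [Nonempty T] :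
    N * density A ≤ codeAvg (fun C : Fin M → Fin N → T => maxHits A C) := by
  rw [← codeAvg_hits A (M := M) (N := N) 0]
  exact codeAvg_mono fun C => hits_le_maxHits A C 0

/-- The maximum is at least `1` unless none of the `MN` codewords hits. That event has probability
`(1 - p)^{MN} ≤ 1/(1 + MNp)`, by Bernoulli's inequality and `(1 - p)(1 + p) ≤ 1`. -/
theorem div_le_codeAvg_maxHits [NeZero M] [Nonempty T] :
    M * N * density A / (1 + M * N * density A)
      ≤ codeAvg (fun C : Fin M → Fin N → T => maxHits A C) := by
  have hpt : ∀ C : Fin M → Fin N → T,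
      1 + (-1) * ∏ w, ∏ b, (1 - if C w b ∈ A then (1 : ℝ) else 0) ≤ maxHits A C := fun C => by
    by_cases h : ∃ w b, C w b ∈ A
    · obtain ⟨w, b, hb⟩ := h
      rw [Finset.prod_eq_zero (Finset.mem_univ w)
        (Finset.prod_eq_zero (Finset.mem_univ b) (by simp [hb]))]
      refine le_trans ?_ (hits_le_maxHits A C w)
      unfold hits
      refine le_trans ?_ (Finset.single_le_sum (fun b _ => by split_ifs <;> norm_num)
        (Finset.mem_univ b))
      simp [hb]
    · push Not at h
      simp [h, maxHits_nonneg]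
  refine le_trans ?_ (codeAvg_mono hpt)
  rw [codeAvg_add, codeAvg_const, codeAvg_mul_left, codeAvg_no_hit]
  have hd := density_nonneg A
  have hd1 := density_le_one A
  have hb : 1 + M * N * density A ≤ (1 + density A) ^ (M * N) := by
    have := one_add_mul_le_pow (a := density A) (by linarith) (M * N)
    push_cast at this
    exact this
  have hy : 0 < 1 + M * N * density A := by positivity
  have hm : (1 - density A) ^ (M * N) * (1 + M * N * density A) ≤ 1 := by
    calc (1 - density A) ^ (M * N) * (1 + M * N * density A)
        ≤ (1 - density A) ^ (M * N) * (1 + density A) ^ (M * N) := by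
          gcongr
      _ = (1 - density A ^ 2) ^ (M * N) := by rw [← mul_pow]; ring
      _ ≤ 1 := pow_le_one₀ (by nlinarith) (by nlinarith)
  rw [div_le_iff₀ hy]
  linarith

end RandomCode

/-! ### Decomposition of the optimum decoder over joint types -/

section Decoding

variable {X Z : Type*} [Fintype X] [DecidableEq X] [Fintype Z] [DecidableEq Z]
  {W : X → Z → ℝ} {n M N : ℕ}

omit [Fintype X] [DecidableEq X] [DecidableEq Z] in
theorem correctProb_eq [NeZero M] (C : Code X n M N) :
    correctProb W C = (1 / (M : ℝ)) * ∑ z, subcodeProb W C (optDecoder W C z) z := by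
  classical
  unfold correctProb
  congr 1
  rw [← Finset.sum_fiberwise (s := Finset.univ) (g := fun z => optDecoder W C z)
    (f := fun z => subcodeProb W C (optDecoder W C z) z)]
  refine Finset.sum_congr rfl fun w _ => ?_
  refine Finset.sum_congr (by ext; simp) fun z hz => ?_
  rw [(Finset.mem_filter.1 hz).2]

omit [Fintype X] [DecidableEq X] [Fintype Z] [DecidableEq Z] in
theorem subcodeProb_le_optDecoder [NeZero M] (C : Code X n M N) (z : Fin n → Z) (w : Fin M) :
    subcodeProb W C w z ≤ subcodeProb W C (optDecoder W C z) z :=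
  (Finite.exists_max fun w => subcodeProb W C w z).choose_spec w

/-- The probability of a transition with joint letter counts `k`. -/
def countWeight (W : X → Z → ℝ) (k : X × Z → ℕ) : ℝ := ∏ p, W p.1 p.2 ^ k p

omit [DecidableEq X] [DecidableEq Z] in
theorem countWeight_nonneg (hW : IsChannel W) (k : X × Z → ℕ) : 0 ≤ countWeight W k :=
  Finset.prod_nonneg fun p _ => pow_nonneg ((hW p.1).1 p.2) _

theorem wordProb_eq_countWeight {k : X × Z → ℕ} {x : Fin n → X} {z : Fin n → Z}
    (h : pairWord x z ∈ typeClass n k) : wordProb W x z = countWeight W k := by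
  unfold wordProb countWeight
  rw [← Finset.prod_fiberwise (s := Finset.univ) (g := pairWord x z)]
  refine Finset.prod_congr rfl fun p _ => ?_
  rw [← mem_typeClass.1 h p, ← Finset.prod_const]
  refine Finset.prod_congr rfl fun i hi => ?_
  have := (Finset.mem_filter.1 hi).2
  rw [← this]; rfl

/-- All families of letter counts bounded by the block length. -/
def countFamilies (A : Type*) [Fintype A] [DecidableEq A] (n : ℕ) : Finset (A → ℕ) :=
  Fintype.piFinset fun _ => Finset.range (n + 1)

theorem card_countFamilies (A : Type*) [Fintype A] [DecidableEq A] (n : ℕ) :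
    (countFamilies A n).card = (n + 1) ^ Fintype.card A := by
  simp [countFamilies]

theorem sum_indicator_typeClass (x : Fin n → X) (z : Fin n → Z) :
    wordProb W x z = ∑ k ∈ countFamilies (X × Z) n,
      countWeight W k * if pairWord x z ∈ typeClass n k then 1 else 0 := by
  set k₀ : X × Z → ℕ := fun p => (Finset.univ.filter fun i => pairWord x z i = p).card with hk₀
  have hmem : pairWord x z ∈ typeClass n k₀ := mem_typeClass.2 fun _ => rfl
  rw [Finset.sum_eq_single k₀]
  · simp [hmem, wordProb_eq_countWeight hmem]
  · intro k _ hk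
    rw [if_neg, mul_zero]
    intro h
    exact hk (funext fun p => ((mem_typeClass.1 h p).symm.trans (mem_typeClass.1 hmem p)))
  · intro h
    refine absurd ?_ h
    simp only [countFamilies, Fintype.mem_piFinset, Finset.mem_range, Nat.lt_succ_iff]
    exact fun p => (Finset.card_le_univ _).trans (by simp)

/-- The words of composition `c` having joint letter counts `k` with `z`. -/
def jointSlice (c : X → ℕ) (k : X × Z → ℕ) (z : Fin n → Z) : Finset (typeClass n c) :=
  Finset.univ.filter fun t => pairWord (t : Fin n → X) z ∈ typeClass n k

variable {c : X → ℕ}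

theorem subcodeProb_eq_sum_hits (C : Fin M → Fin N → typeClass n c) (w : Fin M) (z : Fin n → Z) :
    subcodeProb W (fun w b => (C w b : Fin n → X)) w z
      = (1 / (N : ℝ)) * ∑ k ∈ countFamilies (X × Z) n,
          countWeight W k * hits (jointSlice c k z) C w := by
  unfold subcodeProb
  congr 1
  simp only [hits, Finset.mul_sum]
  rw [Finset.sum_comm]
  refine Finset.sum_congr rfl fun b _ => ?_
  rw [sum_indicator_typeClass]
  simp [jointSlice]

/-- The maximum over messages of a sum over joint types is at most the sum of the maxima. -/
theorem correctProb_le_sum_maxHits (hW : IsChannel W) [NeZero M]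
    (C : Fin M → Fin N → typeClass n c) :
    correctProb W (fun w b => (C w b : Fin n → X))
      ≤ (1 / (M : ℝ)) * ((1 / (N : ℝ)) * ∑ k ∈ countFamilies (X × Z) n,
          countWeight W k * ∑ z, maxHits (jointSlice c k z) C) := by
  rw [correctProb_eq]
  gcongr
  simp only [Finset.mul_sum]
  rw [Finset.sum_comm]
  refine Finset.sum_le_sum fun z _ => ?_
  rw [subcodeProb_eq_sum_hits]
  simp only [Finset.mul_sum]
  gcongr
  · exact countWeight_nonneg hW _
  · exact hits_le_maxHits _ _ _

/-- The optimum decoder does at least as well as one that picks the sub-code with the most words of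
joint type `k`. -/
theorem maxHits_le_correctProb (hW : IsChannel W) [NeZero M]
    (C : Fin M → Fin N → typeClass n c) {k : X × Z → ℕ} (hk : k ∈ countFamilies (X × Z) n) :
    (1 / (M : ℝ)) * ((1 / (N : ℝ)) * (countWeight W k * ∑ z, maxHits (jointSlice c k z) C))
      ≤ correctProb W (fun w b => (C w b : Fin n → X)) := by
  rw [correctProb_eq]
  gcongr
  simp only [Finset.mul_sum]
  refine Finset.sum_le_sum fun z _ => ?_
  obtain ⟨w, hw⟩ := exists_hits_eq_maxHits (jointSlice c k z) C
  refine le_trans ?_ (subcodeProb_le_optDecoder _ z w)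
  rw [subcodeProb_eq_sum_hits, hw]
  gcongr
  exact Finset.single_le_sum
    (f := fun k => countWeight W k * hits (jointSlice c k z) C w)
    (fun k _ => mul_nonneg (countWeight_nonneg hW k) (hits_nonneg _ _ _)) hk

/-- The probability that a uniform word of composition `c` has joint letter counts `k` with a
given word `z` of the right composition. -/
def jointProb (n : ℕ) (c : X → ℕ) (k : X × Z → ℕ) : ℝ :=
  ((typeClass n k).card : ℝ) /
    ((typeClass n c).card * (typeClass n fun b => ∑ a, k (a, b)).card)

theorem density_jointSlice {k : X × Z → ℕ} (hk : ∀ a, ∑ b, k (a, b) = c a) {z : Fin n → Z}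
    (hz : z ∈ typeClass n fun b => ∑ a, k (a, b)) :
    density (jointSlice c k z) = jointProb n c k := by
  have hc : (fun a => ∑ b, k (a, b)) = c := funext hk
  have hcard : (jointSlice c k z).card
      = (Finset.univ.filter fun x : Fin n → X => pairWord x z ∈ typeClass n k).card := by
    refine Finset.card_bij' (fun t _ => (t : Fin n → X))
      (fun x hx => ⟨x, hc ▸ left_mem_typeClass (Finset.mem_filter.1 hx).2⟩) ?_ ?_ ?_ ?_ <;>
    simp [jointSlice]
  have hpos : ((typeClass n fun b => ∑ a, k (a, b)).card : ℝ) ≠ 0 := by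
    exact_mod_cast (Finset.card_pos.2 ⟨z, hz⟩).ne'
  unfold density jointProb
  rw [← card_conditional_typeClass hz, hcard, Fintype.card_coe]
  push_cast
  rw [mul_comm ((typeClass n c).card : ℝ), mul_div_mul_left _ _ hpos]

theorem jointSlice_eq_empty_of_right {k : X × Z → ℕ} {z : Fin n → Z}
    (hz : z ∉ typeClass n fun b => ∑ a, k (a, b)) : jointSlice c k z = ∅ := by
  rw [jointSlice, Finset.filter_eq_empty_iff]
  exact fun t _ h => hz (right_mem_typeClass h)

theorem jointSlice_eq_empty_of_left {k : X × Z → ℕ} {z : Fin n → Z}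
    (hk : ¬ ∀ a, ∑ b, k (a, b) = c a) : jointSlice c k z = ∅ := by
  rw [jointSlice, Finset.filter_eq_empty_iff]
  refine fun t _ h => hk fun a => ?_
  exact (mem_typeClass.1 (left_mem_typeClass h) a).symm.trans (mem_typeClass.1 t.2 a)

omit [Fintype X] [DecidableEq X] [Fintype Z] [DecidableEq Z] in
theorem maxHits_empty {T : Type*} [Fintype T] [DecidableEq T] [NeZero M] (C : Fin M → Fin N → T) :
    maxHits ∅ C = 0 := by
  obtain ⟨w, hw⟩ := exists_hits_eq_maxHits ∅ C
  simp [hw, hits]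

/-- The contribution of the joint letter counts `k` to the probability of correct decoding. -/
def termProb (W : X → Z → ℝ) (n M N : ℕ) (c : X → ℕ) (k : X × Z → ℕ) : ℝ :=
  countWeight W k * ((typeClass n k).card / (typeClass n c).card) *
    max (1 / (M : ℝ)) (min 1 (1 / (M * N * jointProb n c k)))

theorem sum_codeAvg_maxHits [NeZero M] (k : X × Z → ℕ) :
    ∑ z : Fin n → Z, codeAvg (fun C : Fin M → Fin N → typeClass n c => maxHits (jointSlice c k z) C)
      = ∑ z ∈ typeClass n fun b => ∑ a, k (a, b),
          codeAvg (fun C : Fin M → Fin N → typeClass n c => maxHits (jointSlice c k z) C) := by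
  symm
  refine Finset.sum_subset (Finset.subset_univ _) fun z _ hz => ?_
  rw [jointSlice_eq_empty_of_right hz]
  simp [maxHits_empty, codeAvg]

theorem sum_eq_of_marginal {k : X × Z → ℕ} (hc : ∑ a, c a = n)
    (hk : ∀ a, ∑ b, k (a, b) = c a) : ∑ p, k p = n := by
  rw [Fintype.sum_prod_type, ← hc]
  exact Finset.sum_congr rfl fun a _ => hk a

theorem sum_right_eq_of_marginal {k : X × Z → ℕ} (hc : ∑ a, c a = n)
    (hk : ∀ a, ∑ b, k (a, b) = c a) : ∑ b, ∑ a, k (a, b) = n := by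
  rw [Finset.sum_comm, ← hc]
  exact Finset.sum_congr rfl fun a _ => hk a

theorem jointProb_pos {k : X × Z → ℕ} (hc : ∑ a, c a = n)
    (hk : ∀ a, ∑ b, k (a, b) = c a) : 0 < jointProb n c k := by
  have h1 := (typeClass_nonempty (sum_eq_of_marginal hc hk)).card_pos
  have h2 := (typeClass_nonempty hc).card_pos
  have h3 := (typeClass_nonempty (sum_right_eq_of_marginal hc hk)).card_pos
  unfold jointProb
  positivity

theorem card_mul_jointProb {k : X × Z → ℕ} (hc : ∑ a, c a = n)
    (hk : ∀ a, ∑ b, k (a, b) = c a) :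
    ((typeClass n fun b => ∑ a, k (a, b)).card : ℝ) * jointProb n c k
      = (typeClass n k).card / (typeClass n c).card := by
  have h3 : ((typeClass n fun b => ∑ a, k (a, b)).card : ℝ) ≠ 0 := by
    exact_mod_cast (typeClass_nonempty (sum_right_eq_of_marginal hc hk)).card_pos.ne'
  unfold jointProb
  rw [mul_comm ((typeClass n c).card : ℝ), ← div_div, mul_div_assoc', mul_div_assoc',
    mul_div_cancel_left₀ _ h3]

/-- For `MNp ≤ 1` the union bound is used. Otherwise the logarithmic bound is, since both `1` and
`Np` are then at most `MNp` times the maximum in `termProb`. -/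
theorem sum_codeAvg_maxHits_le [NeZero M] [NeZero N] {k : X × Z → ℕ} (hW : IsChannel W)
    (hc : ∑ a, c a = n) (hk : ∀ a, ∑ b, k (a, b) = c a) :
    (1 / (M : ℝ)) * ((1 / (N : ℝ)) * (countWeight W k *
      ∑ z : Fin n → Z,
        codeAvg (fun C : Fin M → Fin N → typeClass n c => maxHits (jointSlice c k z) C)))
      ≤ (Real.log M + 2) * termProb W n M N c k := by
  have hM : (0 : ℝ) < M := by exact_mod_cast NeZero.pos M
  have hM1 : (1 : ℝ) ≤ M := by exact_mod_cast NeZero.pos M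
  have hN : (0 : ℝ) < N := by exact_mod_cast NeZero.pos N
  have hlog : 0 ≤ Real.log M := Real.log_nonneg hM1
  have hne : Nonempty (typeClass n c) := (typeClass_nonempty hc).to_subtype
  have hp := jointProb_pos hc hk
  have hw := countWeight_nonneg hW k
  set p := jointProb n c k with hpdef
  set S := ((typeClass n fun b => ∑ a, k (a, b)).card : ℝ) with hS
  have h1 : ∑ z : Fin n → Z,
      codeAvg (fun C : Fin M → Fin N → typeClass n c => maxHits (jointSlice c k z) C)
      ≤ S * min (M * N * p) (Real.log M + 2 * (N * p)) := by
    rw [sum_codeAvg_maxHits, hS, ← nsmul_eq_mul]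
    refine Finset.sum_le_card_nsmul _ _ _ fun z hz => ?_
    rw [hpdef, ← density_jointSlice hk hz]
    exact le_min (codeAvg_maxHits_le_mul _) (codeAvg_maxHits_le_log _)
  have h2 : min (M * N * p) (Real.log M + 2 * (N * p))
      ≤ M * N * p * ((Real.log M + 2) * max (1 / (M : ℝ)) (min 1 (1 / (M * N * p)))) := by
    rcases le_total 1 (1 / (M * N * p)) with h | h
    · rw [min_eq_left h]
      refine (min_le_left _ _).trans ?_
      have : (1 : ℝ) ≤ (Real.log M + 2) * max (1 / (M : ℝ)) 1 := by
        have := le_max_right (1 / (M : ℝ)) 1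
        nlinarith
      nlinarith [mul_pos (mul_pos hM hN) hp]
    · rw [min_eq_right h]
      refine (min_le_right _ _).trans ?_
      have e1 := le_max_left (1 / (M : ℝ)) (1 / (M * N * p))
      have e2 := le_max_right (1 / (M : ℝ)) (1 / (M * N * p))
      set m := max (1 / (M : ℝ)) (1 / (M * N * p))
      have e3 : N * p ≤ M * N * p * m := by
        calc N * p = M * N * p * (1 / M) := by field_simp
          _ ≤ _ := by gcongr
      have e4 : 1 ≤ M * N * p * m := by
        calc 1 = M * N * p * (1 / (M * N * p)) := by field_simp
          _ ≤ _ := by gcongr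
      nlinarith
  calc _ ≤ (1 / (M : ℝ)) * ((1 / (N : ℝ)) * (countWeight W k *
      (S * (M * N * p * ((Real.log M + 2) * max (1 / (M : ℝ)) (min 1 (1 / (M * N * p)))))))) := by
        gcongr
        exact h1.trans (by gcongr)
    _ = _ := by
        rw [termProb, ← card_mul_jointProb hc hk, ← hpdef, ← hS]
        set m := max (1 / (M : ℝ)) (min 1 (1 / (M * N * p)))
        field_simp

/-- The constant `1/2` comes from `y/(1 + y) ≥ min(y, 1)/2` with `y = MNp`. -/
theorem le_sum_codeAvg_maxHits [NeZero M] [NeZero N] {k : X × Z → ℕ} (hW : IsChannel W)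
    (hc : ∑ a, c a = n) (hk : ∀ a, ∑ b, k (a, b) = c a) :
    (1 / 2) * termProb W n M N c k ≤
    (1 / (M : ℝ)) * ((1 / (N : ℝ)) * (countWeight W k *
      ∑ z : Fin n → Z,
        codeAvg (fun C : Fin M → Fin N → typeClass n c => maxHits (jointSlice c k z) C))) := by
  have hM : (0 : ℝ) < M := by exact_mod_cast NeZero.pos M
  have hN : (0 : ℝ) < N := by exact_mod_cast NeZero.pos N
  have hne : Nonempty (typeClass n c) := (typeClass_nonempty hc).to_subtype
  have hp := jointProb_pos hc hk
  have hw := countWeight_nonneg hW k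
  set p := jointProb n c k with hpdef
  set S := ((typeClass n fun b => ∑ a, k (a, b)).card : ℝ) with hS
  have h1 : S * max (N * p) (M * N * p / (1 + M * N * p)) ≤ ∑ z : Fin n → Z,
      codeAvg (fun C : Fin M → Fin N → typeClass n c => maxHits (jointSlice c k z) C) := by
    rw [sum_codeAvg_maxHits, hS, ← nsmul_eq_mul]
    refine Finset.card_nsmul_le_sum _ _ _ fun z hz => ?_
    rw [hpdef, ← density_jointSlice hk hz]
    exact max_le (le_codeAvg_maxHits _) (div_le_codeAvg_maxHits _)
  have hy : 0 < M * N * p := by positivity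
  have h2 : (1 / 2) * (M * N * p * max (1 / (M : ℝ)) (min 1 (1 / (M * N * p))))
      ≤ max (N * p) (M * N * p / (1 + M * N * p)) := by
    rcases max_choice (1 / (M : ℝ)) (min 1 (1 / (M * N * p))) with h | h <;> rw [h]
    · refine le_trans ?_ (le_max_left _ _)
      have : M * N * p * (1 / (M : ℝ)) = N * p := by field_simp
      rw [this]; nlinarith [mul_pos hN hp]
    · refine le_trans ?_ (le_max_right _ _)
      set y := M * N * p
      rw [mul_left_comm, div_eq_mul_inv y]
      refine mul_le_mul_of_nonneg_left ?_ hy.le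
      rw [← one_div (1 + y), le_div_iff₀ (by positivity)]
      have e1 := min_le_left 1 (1 / y)
      have e2 : min 1 (1 / y) * y ≤ 1 := by
        calc min 1 (1 / y) * y ≤ 1 / y * y := by gcongr; exact min_le_right _ _
          _ = 1 := by field_simp
      linarith
  calc (1 / 2) * termProb W n M N c k
      = (1 / (M : ℝ)) * ((1 / (N : ℝ)) * (countWeight W k *
      (S * ((1 / 2) * (M * N * p * max (1 / (M : ℝ)) (min 1 (1 / (M * N * p)))))))) := by
        rw [termProb, ← card_mul_jointProb hc hk, ← hpdef, ← hS]
        set m := max (1 / (M : ℝ)) (min 1 (1 / (M * N * p)))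
        field_simp
    _ ≤ _ := by
        gcongr
        exact le_trans (by gcongr) h1

end Decoding

/-! ### Two-sided bounds on the ensemble average at fixed block length -/

section Ensemble

variable {X Z : Type*} [Fintype X] [DecidableEq X] [Fintype Z] [DecidableEq Z]
  {W : X → Z → ℝ}

theorem avgCorrectProb_eq (e : EnsembleParams X) :
    avgCorrectProb W e = codeAvg (fun C : Fin e.M → Fin e.M₂ → typeClass e.n e.c =>
      correctProb W (fun w b => (C w b : Fin e.n → X))) := rfl

/-- Joint types with the wrong input marginal have empty slices, and those using a forbidden
transition have zero weight, so only the remaining ones need the bound `B`. -/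
theorem avgCorrectProb_le (hW : IsChannel W) (e : EnsembleParams X) {B : ℝ} (hB : 0 ≤ B)
    (h : ∀ k : X × Z → ℕ, (∀ a, ∑ b, k (a, b) = e.c a) → (∀ a b, W a b = 0 → k (a, b) = 0) →
      termProb W e.n e.M e.M₂ e.c k ≤ B) :
    avgCorrectProb W e
      ≤ (e.n + 1) ^ Fintype.card (X × Z) * ((Real.log (e.M : ℕ) + 2) * B) := by
  have hM1 : (1 : ℝ) ≤ (e.M : ℕ) := by exact_mod_cast e.M.pos
  have hlog : 0 ≤ Real.log (e.M : ℕ) := Real.log_nonneg hM1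
  rw [avgCorrectProb_eq]
  refine (codeAvg_mono (correctProb_le_sum_maxHits hW)).trans ?_
  rw [codeAvg_mul_left, codeAvg_mul_left, codeAvg_sum, Finset.mul_sum, Finset.mul_sum]
  have hcard : ((e.n : ℝ) + 1) ^ Fintype.card (X × Z) = (countFamilies (X × Z) e.n).card := by
    rw [card_countFamilies]; push_cast; rfl
  rw [hcard, ← nsmul_eq_mul]
  refine Finset.sum_le_card_nsmul _ _ _ fun k _ => ?_
  rw [codeAvg_mul_left, codeAvg_sum]
  by_cases hk : ∀ a, ∑ b, k (a, b) = e.c a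
  · by_cases hkW : ∀ a b, W a b = 0 → k (a, b) = 0
    · refine (sum_codeAvg_maxHits_le hW e.sum_c hk).trans ?_
      gcongr
      exact h k hk hkW
    · push Not at hkW
      obtain ⟨a, b, h0, hk0⟩ := hkW
      have : countWeight W k = 0 :=
        Finset.prod_eq_zero (Finset.mem_univ (a, b)) (by simp [h0, hk0])
      rw [this]
      simp only [zero_mul, mul_zero]
      positivity
  · have : ∀ z : Fin e.n → Z, codeAvg (fun C : Fin e.M → Fin e.M₂ → typeClass e.n e.c =>
        maxHits (jointSlice e.c k z) C) = 0 := fun z => by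
      rw [jointSlice_eq_empty_of_left hk]
      simp [maxHits_empty, codeAvg]
    simp only [this, Finset.sum_const_zero, mul_zero]
    positivity

theorem le_avgCorrectProb (hW : IsChannel W) (e : EnsembleParams X) {k : X × Z → ℕ}
    (hk : ∀ a, ∑ b, k (a, b) = e.c a) :
    (1 / 2) * termProb W e.n e.M e.M₂ e.c k ≤ avgCorrectProb W e := by
  have hmem : k ∈ countFamilies (X × Z) e.n := by
    simp only [countFamilies, Fintype.mem_piFinset, Finset.mem_range, Nat.lt_succ_iff]
    exact fun p => (Finset.single_le_sum (fun _ _ => Nat.zero_le _) (Finset.mem_univ p)).trans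
      (sum_eq_of_marginal e.sum_c hk).le
  refine (le_sum_codeAvg_maxHits hW e.sum_c hk).trans ?_
  rw [avgCorrectProb_eq, ← codeAvg_sum, ← codeAvg_mul_left, ← codeAvg_mul_left,
    ← codeAvg_mul_left]
  exact codeAvg_mono fun C => maxHits_le_correctProb hW C hmem

end Ensemble

/-! ### The objective as a continuous function of the joint law -/

section Objective

variable {X Z : Type*} [Fintype X] [Fintype Z]

/-- `D(Q‖W|P)` as a function of the joint law `q = P × Q`, when `q` vanishes where `W` does. -/
def jointDiv (W q : X → Z → ℝ) : ℝ :=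
  ∑ a, Real.negMulLog (∑ b, q a b) - ∑ a, ∑ b, Real.negMulLog (q a b)
    - ∑ a, ∑ b, q a b * Real.log (W a b)

/-- The mutual information as a function of the joint law. -/
def jointInfo (q : X → Z → ℝ) : ℝ :=
  ∑ a, Real.negMulLog (∑ b, q a b) + ∑ b, Real.negMulLog (∑ a, q a b)
    - ∑ a, ∑ b, Real.negMulLog (q a b)

/-- `D + [R₁ - max (I, R₂)]₊` as a function of the joint law, for `R₂ ≤ R₁`. -/
def objective (W q : X → Z → ℝ) (r₁ r₂ : ℝ) : ℝ :=
  jointDiv W q + min (r₁ - r₂) (max 0 (r₁ - jointInfo q))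

-- `Real.negMulLog` is continuous at `0` and the `Real.log (W a b)` are constants, with value `0`
-- where `W a b = 0`. No support condition is therefore needed here, although the value means a
-- divergence only for dominated laws.
@[fun_prop]
theorem continuous_jointDiv (W : X → Z → ℝ) : Continuous (jointDiv W) := by
  unfold jointDiv
  have h := Real.continuous_negMulLog
  fun_prop

@[fun_prop]
theorem continuous_jointInfo : Continuous (jointInfo : (X → Z → ℝ) → ℝ) := by
  unfold jointInfo
  have h := Real.continuous_negMulLog
  fun_prop

theorem continuous_objective (W : X → Z → ℝ) :
    Continuous fun p : (X → Z → ℝ) × ℝ × ℝ => objective W p.1 p.2.1 p.2.2 := by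
  unfold objective
  fun_prop

end Objective

/-! ### Exponential estimate of one joint type -/

section TermEstimate

variable {X Z : Type*} [Fintype X] [DecidableEq X] [Fintype Z] [DecidableEq Z]
  {W : X → Z → ℝ} {n M N : ℕ} {c : X → ℕ}

/-- The empirical joint law with letter counts `k`. -/
def empirical (n : ℕ) (k : X × Z → ℕ) (a : X) (b : Z) : ℝ := (k (a, b) : ℝ) / n

omit [DecidableEq X] [DecidableEq Z] in
theorem log_countWeight (k : X × Z → ℕ) (hk : ∀ a b, W a b = 0 → k (a, b) = 0) :
    Real.log (countWeight W k) = ∑ a, ∑ b, k (a, b) * Real.log (W a b) := by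
  unfold countWeight
  rw [Real.log_prod, Fintype.sum_prod_type]
  · simp
  · rintro ⟨a, b⟩ _
    by_cases h : W a b = 0
    · simp [hk a b h]
    · exact pow_ne_zero _ h

omit [DecidableEq X] [DecidableEq Z] in
theorem countWeight_pos (hW : IsChannel W) (k : X × Z → ℕ)
    (hk : ∀ a b, W a b = 0 → k (a, b) = 0) : 0 < countWeight W k := by
  refine Finset.prod_pos fun p _ => ?_
  by_cases h : W p.1 p.2 = 0
  · simp [hk p.1 p.2 h]
  · exact pow_pos (lt_of_le_of_ne ((hW p.1).1 p.2) (Ne.symm h)) _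

theorem termProb_pos [NeZero M] {k : X × Z → ℕ} (hW : IsChannel W) (hc : ∑ a, c a = n)
    (hk : ∀ a, ∑ b, k (a, b) = c a) (hkW : ∀ a b, W a b = 0 → k (a, b) = 0) :
    0 < termProb W n M N c k := by
  have hM : (0 : ℝ) < M := by exact_mod_cast NeZero.pos M
  have h1 := countWeight_pos hW k hkW
  have h2 := (typeClass_nonempty (sum_eq_of_marginal hc hk)).card_pos
  have h3 := (typeClass_nonempty hc).card_pos
  have h4 : 0 < max (1 / (M : ℝ)) (min 1 (1 / (M * N * jointProb n c k))) :=
    lt_max_of_lt_left (by positivity)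
  unfold termProb
  positivity

/-- Clamping is 1-Lipschitz, so the error in `log p` passes unamplified to the rate term. -/
theorem abs_max_min_sub_le (a u v : ℝ) :
    |max a (min 0 u) - max a (min 0 v)| ≤ |u - v| := by
  have h1 : |min 0 u - min 0 v| ≤ |u - v| := by
    have := abs_min_sub_min_le_max 0 u 0 v
    simpa using this
  have h2 := abs_max_sub_max_le_max a (min 0 u) a (min 0 v)
  simp only [sub_self, abs_zero, abs_nonneg, sup_of_le_right] at h2
  exact h2.trans h1

/-- The number of factorial errors made in estimating one term of the probability of correct
decoding. -/
def errorFactor (X Z : Type*) [Fintype X] [Fintype Z] : ℝ :=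
  2 * Fintype.card (X × Z) + 2 * Fintype.card X + Fintype.card Z + 5

/-- The weight and the two type classes produce `e^{-nD}`, with `|X × Z| + |X| + 2` factorial
errors; `jointProb` is `e^{-nI}`, with `|X × Z| + |X| + |Z| + 3`. Their sum is `errorFactor`. -/
theorem abs_log_termProb_add_le [NeZero M] [NeZero N] {k : X × Z → ℕ} (hW : IsChannel W)
    (hn : 0 < n) (hc : ∑ a, c a = n) (hk : ∀ a, ∑ b, k (a, b) = c a)
    (hkW : ∀ a b, W a b = 0 → k (a, b) = 0) :
    |Real.log (termProb W n M N c k)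
        + n * objective W (empirical n k) ((Real.log M + Real.log N) / n) (Real.log N / n)|
      ≤ errorFactor X Z * factorialError n := by
  have hn' : (0 : ℝ) < n := by exact_mod_cast hn
  have hM : (0 : ℝ) < M := by exact_mod_cast NeZero.pos M
  have hN : (0 : ℝ) < N := by exact_mod_cast NeZero.pos N
  have hp := jointProb_pos hc hk
  have h1 := countWeight_pos hW k hkW
  have c1 : (0 : ℝ) < (typeClass n k).card := by
    exact_mod_cast (typeClass_nonempty (sum_eq_of_marginal hc hk)).card_pos
  have c2 : (0 : ℝ) < (typeClass n c).card := by
    exact_mod_cast (typeClass_nonempty hc).card_pos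
  have c3 : (0 : ℝ) < (typeClass n fun b => ∑ a, k (a, b)).card := by
    exact_mod_cast (typeClass_nonempty (sum_right_eq_of_marginal hc hk)).card_pos
  have e1 := abs_log_card_typeClass_sub_le hn (sum_eq_of_marginal hc hk)
  have e2 := abs_log_card_typeClass_sub_le hn hc
  have e3 := abs_log_card_typeClass_sub_le hn (sum_right_eq_of_marginal hc hk)
  have hlogp : Real.log (jointProb n c k) = Real.log (typeClass n k).card
      - (Real.log (typeClass n c).card
        + Real.log (typeClass n fun b => ∑ a, k (a, b)).card) := by
    unfold jointProb
    rw [Real.log_div c1.ne' (by positivity), Real.log_mul c2.ne' c3.ne']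
  set p := jointProb n c k with hpdef
  set m : ℝ := max (1 / (M : ℝ)) (min 1 (1 / (M * N * p))) with hm
  have hmpos : 0 < m := lt_max_of_lt_left (by positivity)
  have hlogm : Real.log m
      = max (-Real.log M) (min 0 (-(Real.log M + Real.log N + Real.log p))) := by
    have : m = Real.exp (max (-Real.log M)
        (min 0 (-(Real.log M + Real.log N + Real.log p)))) := by
      rw [Real.exp_monotone.map_max, Real.exp_monotone.map_min, Real.exp_neg, Real.exp_neg,
        Real.exp_add, Real.exp_add, Real.exp_log hM, Real.exp_log hN, Real.exp_log hp,
        Real.exp_zero, hm, one_div, one_div]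
    rw [this, Real.log_exp]
  have hlog : Real.log (termProb W n M N c k) = Real.log (countWeight W k)
      + (Real.log (typeClass n k).card - Real.log (typeClass n c).card) + Real.log m := by
    unfold termProb
    rw [← hpdef, ← hm, Real.log_mul (by positivity) hmpos.ne', Real.log_mul h1.ne' (by positivity),
      Real.log_div c1.ne' c2.ne']
  have s1 : ∑ q, Real.negMulLog (k q / n)
      = ∑ a, ∑ b, Real.negMulLog (empirical n k a b) := by
    rw [Fintype.sum_prod_type]; rfl
  have s2 : ∑ a, Real.negMulLog (c a / n)
      = ∑ a, Real.negMulLog (∑ b, empirical n k a b) := by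
    refine Finset.sum_congr rfl fun a _ => ?_
    rw [← hk a]; push_cast; rw [Finset.sum_div]; rfl
  have s3 : ∑ b, Real.negMulLog ((∑ a, k (a, b) : ℕ) / n)
      = ∑ b, Real.negMulLog (∑ a, empirical n k a b) := by
    refine Finset.sum_congr rfl fun b _ => ?_
    push_cast; rw [Finset.sum_div]; rfl
  have s4 : Real.log (countWeight W k)
      = n * ∑ a, ∑ b, empirical n k a b * Real.log (W a b) := by
    rw [log_countWeight k hkW, Finset.mul_sum]
    refine Finset.sum_congr rfl fun a _ => ?_
    rw [Finset.mul_sum]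
    refine Finset.sum_congr rfl fun b _ => ?_
    unfold empirical; field_simp
  rw [s1] at e1
  rw [s2] at e2
  rw [s3] at e3
  have hF := factorialError_nonneg n
  have hdiv : |Real.log (countWeight W k)
      + (Real.log (typeClass n k).card - Real.log (typeClass n c).card)
      + n * jointDiv W (empirical n k)|
      ≤ (Fintype.card (X × Z) + Fintype.card X + 2) * factorialError n := by
    rw [s4]
    unfold jointDiv
    rw [abs_le] at e1 e2 ⊢
    constructor <;> linarith
  have hinfo : |Real.log p + n * jointInfo (empirical n k)|
      ≤ (Fintype.card (X × Z) + Fintype.card X + Fintype.card Z + 3) * factorialError n := by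
    rw [hlogp]
    unfold jointInfo
    rw [abs_le] at e1 e2 e3 ⊢
    constructor <;> linarith
  have hrate : n * min ((Real.log M + Real.log N) / n - Real.log N / n)
      (max 0 ((Real.log M + Real.log N) / n - jointInfo (empirical n k)))
      = - max (-Real.log M)
        (min 0 (-(Real.log M + Real.log N - n * jointInfo (empirical n k)))) := by
    rw [mul_min_of_nonneg _ _ hn'.le, mul_max_of_nonneg _ _ hn'.le, ← min_neg_neg,
      ← max_neg_neg, neg_neg, neg_neg, neg_zero]
    congr 2 <;> field_simp <;> ring
  have hlip := abs_max_min_sub_le (-Real.log M) (-(Real.log M + Real.log N + Real.log p))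
    (-(Real.log M + Real.log N - n * jointInfo (empirical n k)))
  have hu : |-(Real.log M + Real.log N + Real.log p)
      - -(Real.log M + Real.log N - n * jointInfo (empirical n k))|
      ≤ (Fintype.card (X × Z) + Fintype.card X + Fintype.card Z + 3) * factorialError n := by
    rw [abs_sub_comm]
    convert hinfo using 2
    ring
  have hmm := hlip.trans hu
  rw [hlog, hlogm]
  unfold objective errorFactor
  rw [mul_add, hrate]
  rw [abs_le] at hdiv hmm ⊢
  constructor <;> linarith

end TermEstimate

/-! ### Bounds on the normalized exponent at fixed block length -/

section ExponentBounds

variable {X Z : Type*} [Fintype X] [DecidableEq X] [Fintype Z] [DecidableEq Z]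
  {W : X → Z → ℝ}

/-- The empirical total rate of an ensemble. -/
def totalRate (e : EnsembleParams X) : ℝ :=
  (Real.log (e.M : ℕ) + Real.log (e.M₂ : ℕ)) / e.n

/-- The empirical randomization rate of an ensemble. -/
def localRate (e : EnsembleParams X) : ℝ := Real.log (e.M₂ : ℕ) / e.n

theorem normalizedExponent_le (hW : IsChannel W) (e : EnsembleParams X) (hn : 0 < e.n)
    {k : X × Z → ℕ} (hk : ∀ a, ∑ b, k (a, b) = e.c a)
    (hkW : ∀ a b, W a b = 0 → k (a, b) = 0) :
    normalizedExponent W e ≤ objective W (empirical e.n k) (totalRate e) (localRate e)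
      + (errorFactor X Z * factorialError e.n + Real.log 2) / e.n := by
  have hn' : (0 : ℝ) < e.n := by exact_mod_cast hn
  have h1 := le_avgCorrectProb hW e hk
  have h2 : 0 < termProb W e.n e.M e.M₂ e.c k := termProb_pos hW e.sum_c hk hkW
  have h3 := Real.log_le_log (by positivity) h1
  rw [Real.log_mul (by norm_num) h2.ne', one_div, Real.log_inv] at h3
  have h4 := (abs_le.1 (abs_log_termProb_add_le (M := e.M) (N := e.M₂)
    hW hn e.sum_c hk hkW)).1
  unfold normalizedExponent totalRate localRate
  rw [← neg_div, ← sub_le_iff_le_add, ← sub_div, div_le_iff₀ hn']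
  linarith

theorem le_normalizedExponent (hW : IsChannel W) (e : EnsembleParams X) (hn : 0 < e.n) {v : ℝ}
    (hex : ∃ k : X × Z → ℕ, (∀ a, ∑ b, k (a, b) = e.c a) ∧ ∀ a b, W a b = 0 → k (a, b) = 0)
    (h : ∀ k : X × Z → ℕ, (∀ a, ∑ b, k (a, b) = e.c a) → (∀ a b, W a b = 0 → k (a, b) = 0) →
      v ≤ objective W (empirical e.n k) (totalRate e) (localRate e)) :
    v - (errorFactor X Z * factorialError e.n + Fintype.card (X × Z) * Real.log (e.n + 1)
      + Real.log (Real.log (e.M : ℕ) + 2)) / e.n ≤ normalizedExponent W e := by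
  have hn' : (0 : ℝ) < e.n := by exact_mod_cast hn
  have hM1 : (1 : ℝ) ≤ (e.M : ℕ) := by exact_mod_cast e.M.pos
  have hlog : 0 ≤ Real.log (e.M : ℕ) := Real.log_nonneg hM1
  have h1 := avgCorrectProb_le hW e (Real.exp_pos
    (errorFactor X Z * factorialError e.n - e.n * v)).le fun k hk hkW => by
      have h2 : 0 < termProb W e.n e.M e.M₂ e.c k := termProb_pos hW e.sum_c hk hkW
      rw [← Real.log_le_iff_le_exp h2]
      have h4 := (abs_le.1 (abs_log_termProb_add_le (M := e.M) (N := e.M₂)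
        hW hn e.sum_c hk hkW)).2
      have h5 := mul_le_mul_of_nonneg_left (h k hk hkW) hn'.le
      unfold totalRate localRate at h5
      linarith
  obtain ⟨k, hk, hkW⟩ := hex
  -- Positivity must be known before taking logarithms, since `Real.log 0 = 0`; this is the role of
  -- `hex`.
  have hpos : 0 < avgCorrectProb W e :=
    lt_of_lt_of_le (mul_pos (by norm_num) (termProb_pos hW e.sum_c hk hkW))
      (le_avgCorrectProb hW e hk)
  have h6 := Real.log_le_log hpos h1
  rw [Real.log_mul (by positivity) (by positivity), Real.log_mul (by positivity) (by positivity),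
    Real.log_exp, Real.log_pow] at h6
  unfold normalizedExponent
  rw [← neg_div, sub_le_iff_le_add, ← add_div, le_div_iff₀ hn']
  linarith

end ExponentBounds

/-- Round down, then give the missing mass, at most `|A|`, to one letter of positive probability.
Zero entries thus stay zero, which preserves domination by `W`. -/
theorem exists_rounding {A : Type*} [Fintype A] {v : A → ℝ} (hv : v ∈ stdSimplex ℝ A) (m : ℕ) :
    ∃ k : A → ℕ, ∑ a, k a = m ∧ (∀ a, v a = 0 → k a = 0) ∧
      ∀ a, |(k a : ℝ) - m * v a| ≤ Fintype.card A + 1 := by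
  classical
  obtain ⟨a₀, -, ha₀⟩ : ∃ a ∈ Finset.univ, 0 < v a :=
    Finset.exists_lt_of_sum_lt (by simp [hv.2])
  set f : A → ℕ := fun a => ⌊m * v a⌋₊ with hf
  have hnn : ∀ a, 0 ≤ m * v a := fun a => mul_nonneg m.cast_nonneg (hv.1 a)
  have hle : ∀ a, (f a : ℝ) ≤ m * v a := fun a => Nat.floor_le (hnn a)
  have hlt : ∀ a, m * v a ≤ f a + 1 := fun a => (Nat.lt_floor_add_one _).le
  have hmv : ∑ a, m * v a = m := by rw [← Finset.mul_sum, hv.2, mul_one]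
  have hsum : ∑ a, f a ≤ m := by
    have : ((∑ a, f a : ℕ) : ℝ) ≤ m := by
      push_cast
      exact (Finset.sum_le_sum fun a _ => hle a).trans hmv.le
    exact_mod_cast this
  have hrem : ((m - ∑ a, f a : ℕ) : ℝ) ≤ Fintype.card A := by
    have : (m : ℝ) ≤ ∑ a, (f a : ℝ) + Fintype.card A := by
      calc (m : ℝ) = ∑ a, m * v a := hmv.symm
        _ ≤ ∑ a, ((f a : ℝ) + 1) := Finset.sum_le_sum fun a _ => hlt a
        _ = _ := by rw [Finset.sum_add_distrib]; simp
    rw [Nat.cast_sub hsum]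
    push_cast
    linarith
  refine ⟨fun a => f a + if a = a₀ then m - ∑ a, f a else 0, ?_, ?_, ?_⟩
  · rw [Finset.sum_add_distrib, Finset.sum_ite_eq' Finset.univ a₀]
    simp only [Finset.mem_univ, if_true]
    omega
  · intro a ha
    have : a ≠ a₀ := fun h => ha₀.ne' (h ▸ ha)
    simp [this, hf, ha]
  · intro a
    have h0 : (0 : ℝ) ≤ ((if a = a₀ then m - ∑ a, f a else 0 : ℕ) : ℝ) := Nat.cast_nonneg _
    have h1 : ((if a = a₀ then m - ∑ a, f a else 0 : ℕ) : ℝ) ≤ Fintype.card A := by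
      split_ifs
      · exact hrem
      · simp
    rw [abs_le]
    have := hle a
    have := hlt a
    have : (0 : ℝ) ≤ Fintype.card A := Nat.cast_nonneg _
    push_cast at *
    constructor <;> linarith

/-! ### The limiting exponent as a minimum over a compact set of channels -/

section Channels

variable {X Z : Type*} [Fintype X] [Fintype Z] {W : X → Z → ℝ}

/-- The channels whose rows are absolutely continuous with respect to those of `W`. -/
def dominatedChannels (W : X → Z → ℝ) : Set (X → Z → ℝ) :=
  {Q | IsChannel Q ∧ ∀ a b, W a b = 0 → Q a b = 0}

omit [Fintype X] in
theorem self_mem_dominatedChannels (hW : IsChannel W) : W ∈ dominatedChannels W :=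
  ⟨hW, fun _ _ => id⟩

omit [Fintype X] in
theorem isCompact_dominatedChannels : IsCompact (dominatedChannels W) := by
  have h : dominatedChannels W = (Set.univ.pi fun _ => stdSimplex ℝ Z) ∩
      {Q | ∀ a b, W a b = 0 → Q a b = 0} := by
    ext Q; simp [dominatedChannels, IsChannel]
  rw [h]
  refine (isCompact_univ_pi fun _ => isCompact_stdSimplex ℝ Z).inter_right ?_
  simp only [Set.ofPred_forall]
  refine isClosed_iInter fun a => isClosed_iInter fun b => isClosed_iInter fun _ => ?_
  exact isClosed_eq (by fun_prop) continuous_const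

/-- The joint law with input law `P` and channel `Q`. -/
def jointLaw (P : X → ℝ) (Q : X → Z → ℝ) (a : X) (b : Z) : ℝ := P a * Q a b

/-- The minimum of `D + [R₁ - max (I, R₂)]₊` over all channels. -/
def exponentValue (P : X → ℝ) (W : X → Z → ℝ) (r₁ r₂ : ℝ) : ℝ :=
  sInf ((fun Q => objective W (jointLaw P Q) r₁ r₂) '' dominatedChannels W)

theorem continuous_objective_jointLaw :
    Continuous fun p : ((X → ℝ) × ℝ × ℝ) × (X → Z → ℝ) =>
      objective W (jointLaw p.1.1 p.2) p.1.2.1 p.1.2.2 := by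
  have h : Continuous fun p : ((X → ℝ) × ℝ × ℝ) × (X → Z → ℝ) => jointLaw p.1.1 p.2 := by
    unfold jointLaw
    fun_prop
  unfold objective
  fun_prop

theorem isCompact_image_objective (P : X → ℝ) (r₁ r₂ : ℝ) :
    IsCompact ((fun Q => objective W (jointLaw P Q) r₁ r₂) '' dominatedChannels W) := by
  have h : Continuous fun Q : X → Z → ℝ => jointLaw P Q := by
    unfold jointLaw
    fun_prop
  have h' : Continuous fun Q : X → Z → ℝ => objective W (jointLaw P Q) r₁ r₂ := by
    unfold objective
    fun_prop
  exact isCompact_dominatedChannels.image h'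

theorem exponentValue_le {P : X → ℝ} {Q : X → Z → ℝ} (hQ : Q ∈ dominatedChannels W)
    (r₁ r₂ : ℝ) : exponentValue P W r₁ r₂ ≤ objective W (jointLaw P Q) r₁ r₂ :=
  csInf_le (isCompact_image_objective P r₁ r₂).bddBelow ⟨Q, hQ, rfl⟩

theorem exists_eq_exponentValue (hW : IsChannel W) (P : X → ℝ) (r₁ r₂ : ℝ) :
    ∃ Q ∈ dominatedChannels W, objective W (jointLaw P Q) r₁ r₂ = exponentValue P W r₁ r₂ :=
  (isCompact_image_objective P r₁ r₂).sInf_mem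
    ⟨_, W, self_mem_dominatedChannels hW, rfl⟩

/-- Domination is imposed on all rows, including those with `P a = 0`, so the compact constraint set
does not move with `P`. -/
theorem continuous_exponentValue (W : X → Z → ℝ) :
    Continuous fun p : (X → ℝ) × ℝ × ℝ => exponentValue p.1 W p.2.1 p.2.2 := by
  exact (isCompact_dominatedChannels (W := W)).continuous_sInf
    (f := fun (p : (X → ℝ) × ℝ × ℝ) Q => objective W (jointLaw p.1 Q) p.2.1 p.2.2)
    continuous_objective_jointLaw

end Channels

/-! ### The asymptotic regime and convergence of the exponent -/

section Regime

variable {X : Type*} [Fintype X] {P : X → ℝ} {R₁ R₂ : ℝ}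

theorem tendsto_regime_iff {ι : Type*} {l : Filter ι} {e : ι → EnsembleParams X} :
    Tendsto e l (regime P R₁ R₂) ↔
      Tendsto (fun i => (e i).n) l atTop ∧
      Tendsto (fun i a => ((e i).c a : ℝ) / (e i).n) l (𝓝 P) ∧
      Tendsto (fun i => Real.log ((e i).M : ℕ) / (e i).n) l (𝓝 (R₁ - R₂)) ∧
      Tendsto (fun i => Real.log ((e i).M₂ : ℕ) / (e i).n) l (𝓝 R₂) := by
  unfold regime
  simp only [tendsto_inf, tendsto_comap_iff, and_assoc]
  rfl

theorem tendsto_log_ceil_exp_div {R : ℝ} (hR : 0 ≤ R) :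
    Tendsto (fun n : ℕ => Real.log (⌈Real.exp (n * R)⌉₊ : ℕ) / n) atTop (𝓝 R) := by
  have h0 : Tendsto (fun n : ℕ => R + Real.log 2 / n) atTop (𝓝 (R + 0)) :=
    tendsto_const_nhds.add (tendsto_const_div_atTop_nhds_zero_nat _)
  rw [add_zero] at h0
  refine tendsto_of_tendsto_of_tendsto_of_le_of_le' tendsto_const_nhds h0 ?_ ?_
  · filter_upwards [eventually_gt_atTop 0] with n hn
    have hn' : (0 : ℝ) < n := by exact_mod_cast hn
    rw [le_div_iff₀ hn', mul_comm, ← Real.log_exp (n * R)]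
    exact Real.log_le_log (Real.exp_pos _) (by rw [Real.log_exp]; exact Nat.le_ceil _)
  · filter_upwards [eventually_gt_atTop 0] with n hn
    have hn' : (0 : ℝ) < n := by exact_mod_cast hn
    have h1 : (1 : ℝ) ≤ Real.exp (n * R) := Real.one_le_exp (by positivity)
    have h2 : (⌈Real.exp (n * R)⌉₊ : ℝ) ≤ Real.exp (n * R) * 2 := by
      linarith [(Nat.ceil_lt_add_one (Real.exp_pos (n * R)).le).le]
    have h3 := Real.log_le_log (by exact_mod_cast Nat.ceil_pos.2 (Real.exp_pos _)) h2
    rw [Real.log_mul (Real.exp_pos _).ne' (by norm_num), Real.log_exp] at h3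
    rw [div_le_iff₀ hn', add_mul, div_mul_cancel₀ _ hn'.ne']
    linarith

theorem tendsto_div_of_abs_sub_le {ι : Type*} {l : Filter ι} {n : ι → ℕ}
    (hn : Tendsto n l atTop) {u v : ι → ℝ} {K : ℝ} (huv : ∀ i, |u i - n i * v i| ≤ K) {y : ℝ}
    (hv : Tendsto v l (𝓝 y)) : Tendsto (fun i => u i / n i) l (𝓝 y) := by
  have hK : Tendsto (fun i => K / (n i : ℝ)) l (𝓝 0) :=
    (tendsto_const_div_atTop_nhds_zero_nat K).comp hn
  have h0 : Tendsto (fun i => u i / n i - v i) l (𝓝 0) := by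
    refine squeeze_zero_norm' ?_ hK
    filter_upwards [hn.eventually_gt_atTop 0] with i hi
    have hi' : (0 : ℝ) < n i := by exact_mod_cast hi
    have h : u i / n i - v i = (u i - n i * v i) / n i := by field_simp
    rw [Real.norm_eq_abs, h, abs_div, abs_of_pos hi']
    gcongr
    exact huv i
  simpa using h0.add hv

/-- Needed so that convergence along the regime is not vacuous and `limUnder` is the actual limit.
-/
theorem regime_neBot (hP : P ∈ stdSimplex ℝ X) (h2 : 0 ≤ R₂) (h12 : R₂ ≤ R₁) :
    (regime P R₁ R₂).NeBot := by
  choose k hk _ hk' using exists_rounding hP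
  let e : ℕ → EnsembleParams X := fun n =>
    { n := n
      c := k n
      sum_c := hk n
      M := ⟨⌈Real.exp (n * (R₁ - R₂))⌉₊, Nat.ceil_pos.2 (Real.exp_pos _)⟩
      M₂ := ⟨⌈Real.exp (n * R₂)⌉₊, Nat.ceil_pos.2 (Real.exp_pos _)⟩ }
  have h : Tendsto e atTop (regime P R₁ R₂) := by
    refine tendsto_regime_iff.2 ⟨tendsto_id, ?_, tendsto_log_ceil_exp_div (by linarith),
      tendsto_log_ceil_exp_div h2⟩
    refine tendsto_pi_nhds.2 fun a => ?_
    exact tendsto_div_of_abs_sub_le (n := fun n => n) tendsto_id (fun n => hk' n a)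
      tendsto_const_nhds
  exact NeBot.mono (map_neBot (m := e)) h

variable {Z : Type*} [DecidableEq X] [Fintype Z]

/-- Since `u` grows at most linearly in `n`, its logarithm is `o(n)`; this disposes of the `log (n +
1)` and `log (log M + 2)` errors. -/
theorem tendsto_log_add_div {ι : Type*} {l : Filter ι} {n : ι → ℕ}
    (hn : Tendsto n l atTop) {u : ι → ℝ} {y s : ℝ} (hs : 0 < s) (hu : ∀ i, 0 ≤ u i)
    (hy : Tendsto (fun i => u i / n i) l (𝓝 y)) :
    Tendsto (fun i => Real.log (u i + s) / n i) l (𝓝 0) := by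
  have hn' : Tendsto (fun i => (n i : ℝ)) l atTop := tendsto_natCast_atTop_atTop.comp hn
  have h1 : Tendsto (fun i => Real.log (n i) / (n i : ℝ)) l (𝓝 0) := by
    have := Real.isLittleO_log_id_atTop.tendsto_div_nhds_zero
    exact this.comp hn'
  have hc : ∀ a : ℝ, Tendsto (fun i => a / (n i : ℝ)) l (𝓝 0) := fun a =>
    hn'.const_div_atTop a
  have hup : Tendsto (fun i => Real.log (y + 1 + s) / n i + Real.log (n i) / (n i : ℝ)) l
      (𝓝 0) := by simpa using (hc _).add h1
  refine tendsto_of_tendsto_of_tendsto_of_le_of_le' (hc (Real.log s)) hup ?_ ?_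
  · filter_upwards with i
    gcongr
    linarith [hu i]
  · filter_upwards [hn.eventually_ge_atTop 1, hy.eventually_lt_const (lt_add_one y)] with i h h'
    have hi : (1 : ℝ) ≤ n i := by exact_mod_cast h
    have hpos : 0 < (n i : ℝ) := by linarith
    have hy0 : 0 < y + 1 := lt_of_le_of_lt (div_nonneg (hu i) hpos.le) h'
    rw [← add_div, ← Real.log_mul (by positivity) hpos.ne']
    gcongr
    · linarith [hu i]
    · rw [div_lt_iff₀ hpos] at h'
      nlinarith

/-- A squeeze. From above, a minimizing channel is rounded to a joint type with the exact input
composition. From below, every admissible joint type is an input type times a dominated channel,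
hence bounded by `exponentValue` at the empirical parameters, which converges by continuity. -/
theorem tendsto_normalizedExponent {W : X → Z → ℝ} (hW : IsChannel W) :
    Tendsto (normalizedExponent W) (regime P R₁ R₂)
      (𝓝 (exponentValue P W R₁ R₂)) := by
  classical
  obtain ⟨hn, hc, hM, hM₂⟩ := tendsto_regime_iff.1 (tendsto_id (x := regime P R₁ R₂))
  simp only [id] at hn hc hM hM₂
  have hR₁ : Tendsto totalRate (regime P R₁ R₂) (𝓝 R₁) := by
    have := hM.add hM₂
    simp only [sub_add_cancel, ← add_div] at this
    exact this
  have hR₂ : Tendsto localRate (regime P R₁ R₂) (𝓝 R₂) := hM₂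
  have hn' : Tendsto (fun e : EnsembleParams X => (e.n : ℝ)) (regime P R₁ R₂) atTop :=
    tendsto_natCast_atTop_atTop.comp hn
  have hconst : ∀ a : ℝ, Tendsto (fun e : EnsembleParams X => a / (e.n : ℝ)) (regime P R₁ R₂)
    (𝓝 0) := fun a => hn'.const_div_atTop a
  have hlogn : Tendsto (fun e : EnsembleParams X => Real.log (e.n + 1) / e.n) (regime P R₁ R₂)
      (𝓝 0) := by
    refine tendsto_log_add_div hn (y := 1) one_pos (fun e => Nat.cast_nonneg _) ?_
    refine tendsto_const_nhds.congr' ?_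
    filter_upwards [hn'.eventually_gt_atTop 0] with e he
    rw [div_self he.ne']
  have hlogM : Tendsto (fun e : EnsembleParams X => Real.log (Real.log (e.M : ℕ) + 2) / e.n)
      (regime P R₁ R₂) (𝓝 0) :=
    tendsto_log_add_div hn two_pos
      (fun e => Real.log_nonneg (by exact_mod_cast e.M.pos)) hM
  have hF : Tendsto (fun e : EnsembleParams X => factorialError e.n / e.n) (regime P R₁ R₂)
      (𝓝 0) := by
    have := (hlogn.const_mul 2).add (hconst 1)
    simp only [mul_zero, add_zero] at this
    refine this.congr fun e => ?_
    unfold factorialError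
    ring
  have herr₁ : Tendsto (fun e : EnsembleParams X =>
      (errorFactor X Z * factorialError e.n + Fintype.card (X × Z) * Real.log (e.n + 1)
        + Real.log (Real.log (e.M : ℕ) + 2)) / e.n) (regime P R₁ R₂) (𝓝 0) := by
    have := ((hF.const_mul (errorFactor X Z)).add
      (hlogn.const_mul (Fintype.card (X × Z) : ℝ))).add hlogM
    simp only [mul_zero, add_zero] at this
    refine this.congr fun e => ?_
    ring
  have herr₂ : Tendsto (fun e : EnsembleParams X =>
      (errorFactor X Z * factorialError e.n + Real.log 2) / e.n) (regime P R₁ R₂) (𝓝 0) := by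
    have := (hF.const_mul (errorFactor X Z)).add (hconst (Real.log 2))
    simp only [mul_zero, add_zero] at this
    refine this.congr fun e => ?_
    ring
  obtain ⟨Q, hQ, hQmin⟩ := exists_eq_exponentValue hW P R₁ R₂
  -- Row `a` is rounded with denominator `e.c a`, so that the input marginal is met exactly.
  choose r hr hr0 hr' using fun (a : X) (m : ℕ) => exists_rounding (hQ.1 a) m
  let k : EnsembleParams X → X × Z → ℕ := fun e p => r p.1 (e.c p.1) p.2
  have hk : ∀ e : EnsembleParams X, ∀ a, ∑ b, k e (a, b) = e.c a := fun e a => hr a (e.c a)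
  have hkW : ∀ (e : EnsembleParams X) a b, W a b = 0 → k e (a, b) = 0 :=
    fun e a b h => hr0 a _ b (hQ.2 a b h)
  have hkQ : Tendsto (fun e : EnsembleParams X => empirical e.n (k e)) (regime P R₁ R₂)
      (𝓝 (jointLaw P Q)) := by
    refine tendsto_pi_nhds.2 fun a => tendsto_pi_nhds.2 fun b => ?_
    have hv : Tendsto (fun e : EnsembleParams X => (e.c a : ℝ) / e.n * Q a b) (regime P R₁ R₂)
        (𝓝 (P a * Q a b)) := (tendsto_pi_nhds.1 hc a).mul_const _
    refine tendsto_div_of_abs_sub_le (K := Fintype.card Z + 1) hn (fun e => ?_) hv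
    rcases Nat.eq_zero_or_pos e.n with h0 | h0
    · have hca : e.c a = 0 := by
        have := Finset.single_le_sum (f := e.c) (fun _ _ => Nat.zero_le _) (Finset.mem_univ a)
        rw [e.sum_c, h0] at this
        omega
      have := hr' a (e.c a) b
      rw [hca] at this
      simpa [k, hca] using this
    · have : (e.n : ℝ) ≠ 0 := by exact_mod_cast h0.ne'
      have h1 : (e.n : ℝ) * ((e.c a : ℝ) / e.n * Q a b) = e.c a * Q a b := by field_simp
      rw [h1]
      exact hr' a (e.c a) b
  have hupper : Tendsto (fun e : EnsembleParams X =>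
      objective W (empirical e.n (k e)) (totalRate e) (localRate e)
        + (errorFactor X Z * factorialError e.n + Real.log 2) / e.n) (regime P R₁ R₂)
      (𝓝 (exponentValue P W R₁ R₂)) := by
    have h := ((continuous_objective W).tendsto (jointLaw P Q, R₁, R₂)).comp
      (hkQ.prodMk_nhds (hR₁.prodMk_nhds hR₂))
    rw [← hQmin]
    simpa using h.add herr₂
  have hlower : Tendsto (fun e : EnsembleParams X =>
      exponentValue (fun a => (e.c a : ℝ) / e.n) W (totalRate e) (localRate e)
        - (errorFactor X Z * factorialError e.n + Fintype.card (X × Z) * Real.log (e.n + 1)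
        + Real.log (Real.log (e.M : ℕ) + 2)) / e.n) (regime P R₁ R₂)
      (𝓝 (exponentValue P W R₁ R₂)) := by
    have h := ((continuous_exponentValue W).tendsto (P, R₁, R₂)).comp
      (hc.prodMk_nhds (hR₁.prodMk_nhds hR₂))
    simpa using h.sub herr₁
  refine tendsto_of_tendsto_of_tendsto_of_le_of_le' hlower hupper ?_ ?_
  · filter_upwards [hn.eventually_gt_atTop 0] with e he
    refine le_normalizedExponent hW e he ⟨k e, hk e, hkW e⟩ fun l hl hlW => ?_
    -- The empirical conditional law; rows of unused letters are filled with `W a` to stay dominated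
    -- channels.
    let Q' : X → Z → ℝ := fun a b => if e.c a = 0 then W a b else (l (a, b) : ℝ) / e.c a
    have hlaw : empirical e.n l = jointLaw (fun a => (e.c a : ℝ) / e.n) Q' := by
      funext a b
      simp only [empirical, jointLaw, Q']
      split_ifs with h0
      · have : l (a, b) ≤ ∑ b, l (a, b) :=
          Finset.single_le_sum (f := fun b => l (a, b)) (fun _ _ => Nat.zero_le _)
            (Finset.mem_univ b)
        rw [hl a, h0] at this
        have : l (a, b) = 0 := by omega
        simp [this, h0]
      · have : (e.c a : ℝ) ≠ 0 := by exact_mod_cast h0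
        field_simp
    rw [hlaw]
    refine exponentValue_le ⟨fun a => ?_, fun a b h => ?_⟩ _ _
    · by_cases h0 : e.c a = 0
      · simp only [Q', h0, if_true]; exact hW a
      · have h0' : (e.c a : ℝ) ≠ 0 := by exact_mod_cast h0
        simp only [Q', h0, if_false]
        refine ⟨fun b => by positivity, ?_⟩
        rw [← Finset.sum_div]
        have : ∑ b, (l (a, b) : ℝ) = e.c a := by exact_mod_cast hl a
        rw [this, div_self h0']
    · simp only [Q']
      split_ifs
      · exact h
      · simp [hlW a b h]
  · filter_upwards [hn.eventually_gt_atTop 0] with e he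
    exact normalizedExponent_le hW e he (hk e) (hkW e)

end Regime

/-! ### Divergence and mutual information in terms of the joint law -/

section Identities

variable {X Z : Type*} [Fintype X] [Fintype Z] {P : X → ℝ} {W Q : X → Z → ℝ}

/-- `Q` is absolutely continuous with respect to `W` on the support of `P`. -/
def DominatedOn (P : X → ℝ) (Q W : X → Z → ℝ) : Prop := ∀ x z, P x ≠ 0 → W x z = 0 → Q x z = 0

theorem sum_negMulLog_jointLaw (hQ : IsChannel Q) (a : X) :
    ∑ b, Real.negMulLog (jointLaw P Q a b)
      = Real.negMulLog (P a) + P a * ∑ b, Real.negMulLog (Q a b) := by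
  simp only [jointLaw, Real.negMulLog_mul, Finset.sum_add_distrib, ← Finset.sum_mul,
    ← Finset.mul_sum, (hQ a).2, one_mul]

theorem sum_jointLaw (hQ : IsChannel Q) (a : X) : ∑ b, jointLaw P Q a b = P a := by
  simp only [jointLaw, ← Finset.mul_sum, (hQ a).2, mul_one]

theorem jointDiv_jointLaw (hQ : IsChannel Q) (h : DominatedOn P Q W) :
    jointDiv W (jointLaw P Q) = ∑ x, P x * ∑ z, Q x z * Real.log (Q x z / W x z) := by
  unfold jointDiv
  rw [← Finset.sum_sub_distrib, ← Finset.sum_sub_distrib]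
  refine Finset.sum_congr rfl fun a _ => ?_
  rw [sum_jointLaw hQ, sum_negMulLog_jointLaw hQ, sub_add_cancel_left, ← mul_neg,
    ← Finset.sum_neg_distrib]
  simp only [jointLaw, mul_assoc, ← Finset.mul_sum]
  rw [← mul_sub, ← Finset.sum_sub_distrib]
  by_cases ha : P a = 0
  · simp [ha]
  congr 1
  refine Finset.sum_congr rfl fun b _ => ?_
  by_cases hq : Q a b = 0
  · simp [hq]
  · rw [Real.log_div hq fun hw => hq (h a b ha hw), Real.negMulLog]
    ring

theorem condDiv_eq (hQ : IsChannel Q) (h : DominatedOn P Q W) :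
    condDiv P Q W = (jointDiv W (jointLaw P Q) : EReal) := by
  rw [jointDiv_jointLaw hQ h]
  exact if_pos h

theorem condDiv_eq_top (h : ¬ DominatedOn P Q W) : condDiv P Q W = ⊤ :=
  if_neg h

theorem dominatedOn_outputLaw (hP : ∀ a, 0 ≤ P a) (hQ : IsChannel Q) :
    DominatedOn P Q fun _ => outputLaw P Q := by
  intro a b ha h
  have := (Finset.sum_eq_zero_iff_of_nonneg
    fun x _ => mul_nonneg (hP x) ((hQ x).1 b)).1 h a (Finset.mem_univ a)
  exact (mul_eq_zero.1 this).resolve_left ha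

/-- Mutual information is the divergence from the constant channel `outputLaw P Q`, which dominates
`Q` on the support of `P`. -/
theorem mutualInfo_eq (hP : ∀ a, 0 ≤ P a) (hQ : IsChannel Q) :
    mutualInfo P Q = jointInfo (jointLaw P Q) := by
  have h := jointDiv_jointLaw hQ (dominatedOn_outputLaw hP hQ)
  unfold mutualInfo
  rw [← h]
  unfold jointDiv jointInfo
  have : ∑ a, ∑ b, jointLaw P Q a b * Real.log (outputLaw P Q b)
      = - ∑ b, Real.negMulLog (∑ a, jointLaw P Q a b) := by
    rw [Finset.sum_comm, ← Finset.sum_neg_distrib]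
    refine Finset.sum_congr rfl fun b _ => ?_
    rw [← Finset.sum_mul, Real.negMulLog]
    unfold outputLaw jointLaw
    ring
  rw [this]
  ring

theorem sum_mul_log_div_nonneg {p q : Z → ℝ} (hp : p ∈ stdSimplex ℝ Z)
    (hq : q ∈ stdSimplex ℝ Z) (h : ∀ z, q z = 0 → p z = 0) :
    0 ≤ ∑ z, p z * Real.log (p z / q z) := by
  have h1 : ∀ z, p z - q z ≤ p z * Real.log (p z / q z) := fun z => by
    by_cases hpz : p z = 0
    · simp [hpz, hq.1 z]
    · have hp' : 0 < p z := lt_of_le_of_ne (hp.1 z) (Ne.symm hpz)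
      have hq' : 0 < q z := lt_of_le_of_ne (hq.1 z) fun h0 => hpz (h z h0.symm)
      have := one_sub_inv_le_log_div hq' hp'
      rw [Real.log_div hp'.ne' hq'.ne']
      calc p z - q z = p z * (1 - q z / p z) := by field_simp
        _ ≤ _ := by gcongr
  calc (0 : ℝ) = ∑ z, (p z - q z) := by rw [Finset.sum_sub_distrib, hp.2, hq.2, sub_self]
    _ ≤ _ := Finset.sum_le_sum fun z _ => h1 z

theorem jointDiv_nonneg (hP : ∀ a, 0 ≤ P a) (hW : IsChannel W) (hQ : IsChannel Q)
    (h : DominatedOn P Q W) : 0 ≤ jointDiv W (jointLaw P Q) := by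
  rw [jointDiv_jointLaw hQ h]
  refine Finset.sum_nonneg fun a _ => ?_
  by_cases ha : P a = 0
  · simp [ha]
  · exact mul_nonneg (hP a) (sum_mul_log_div_nonneg (hQ a) (hW a) fun z => h a z ha)

theorem isChannel_outputLaw (hP : P ∈ stdSimplex ℝ X) (hQ : IsChannel Q) :
    IsChannel fun _ : X => outputLaw P Q := by
  refine fun _ => ⟨fun z => Finset.sum_nonneg fun x _ => mul_nonneg (hP.1 x) ((hQ x).1 z), ?_⟩
  unfold outputLaw
  rw [Finset.sum_comm]
  simp only [← Finset.mul_sum, (hQ _).2, mul_one]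
  exact hP.2

theorem mutualInfo_nonneg (hP : P ∈ stdSimplex ℝ X) (hQ : IsChannel Q) : 0 ≤ mutualInfo P Q := by
  have h := dominatedOn_outputLaw hP.1 hQ
  have := jointDiv_nonneg hP.1 (isChannel_outputLaw hP hQ) hQ h
  rwa [jointDiv_jointLaw hQ h] at this

theorem jointDiv_self (hW : IsChannel W) : jointDiv W (jointLaw P W) = 0 := by
  rw [jointDiv_jointLaw hW fun _ _ _ => id]
  refine Finset.sum_eq_zero fun a _ => ?_
  rw [Finset.sum_eq_zero fun z _ => ?_, mul_zero]
  by_cases h : W a z = 0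
  · simp [h]
  · simp [div_self h]

/-- Rows with `P a = 0` are invisible in the joint law and may be replaced by those of `W`. -/
theorem exists_dominatedChannels_jointLaw_eq (hW : IsChannel W) (hQ : IsChannel Q)
    (h : DominatedOn P Q W) : ∃ Q' ∈ dominatedChannels W, jointLaw P Q' = jointLaw P Q := by
  classical
  refine ⟨fun a => if P a = 0 then W a else Q a, ⟨fun a => ?_, fun a b hab => ?_⟩, ?_⟩
  · dsimp only
    split_ifs
    exacts [hW a, hQ a]
  · dsimp only
    split_ifs with ha
    exacts [hab, h a b ha hab]
  · funext a b
    simp only [jointLaw]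
    split_ifs with ha
    · simp [ha]
    · rfl

theorem dominatedOn_of_mem (h : Q ∈ dominatedChannels W) : DominatedOn P Q W :=
  fun a b _ => h.2 a b

theorem divSubInfo_eq (hP : ∀ a, 0 ≤ P a) (hQ : IsChannel Q) (h : DominatedOn P Q W) :
    divSubInfo P W Q
      = ((jointDiv W (jointLaw P Q) - jointInfo (jointLaw P Q) : ℝ) : EReal) := by
  rw [divSubInfo, condDiv_eq hQ h, mutualInfo_eq hP hQ, EReal.coe_sub]

theorem divSubInfo_eq_top (h : ¬ DominatedOn P Q W) : divSubInfo P W Q = ⊤ := by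
  rw [divSubInfo, condDiv_eq_top h, EReal.top_sub_coe]

end Identities

/-! ### Full security and the unconstrained minimizer -/

section Characterization

variable {X Z : Type*} [Fintype X] [Fintype Z] {P : X → ℝ} {W : X → Z → ℝ} {R₁ R₂ : ℝ}

theorem coe_sub_le_coe_iff (x : EReal) :
    (R₁ : EReal) - x ≤ (R₂ : EReal) ↔ ((R₁ - R₂ : ℝ) : EReal) ≤ x := by
  induction x with
  | bot => simp [sub_eq_add_neg]
  | top => simp
  | coe x =>
    rw [← EReal.coe_sub, EReal.coe_le_coe_iff, EReal.coe_le_coe_iff]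
    constructor <;> intro h <;> linarith

theorem sub_E3_le_iff (hP : ∀ a, 0 ≤ P a) :
    (R₁ : EReal) - E3 P W R₁ ≤ (R₂ : EReal) ↔
      ∀ Q, IsChannel Q → DominatedOn P Q W → R₁ ≤ jointInfo (jointLaw P Q) →
        R₁ - R₂ ≤ jointDiv W (jointLaw P Q) := by
  rw [coe_sub_le_coe_iff, E3]
  simp only [le_iInf_iff]
  refine forall_congr' fun Q => ⟨fun h hQ hD hI => ?_, fun h hQ => ?_⟩
  · have := h ⟨hQ, by rwa [mutualInfo_eq hP hQ]⟩
    rwa [condDiv_eq hQ hD, EReal.coe_le_coe_iff] at this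
  · by_cases hD : DominatedOn P Q W
    · rw [condDiv_eq hQ.1 hD, EReal.coe_le_coe_iff]
      exact h hQ.1 hD (by rw [← mutualInfo_eq hP hQ.1]; exact hQ.2)
    · rw [condDiv_eq_top hD]; exact le_top

theorem neg_le_minDivSubInfo_iff (hP : ∀ a, 0 ≤ P a) :
    -(R₂ : EReal) ≤ minDivSubInfo P W R₁ R₂ ↔
      ∀ Q, IsChannel Q → DominatedOn P Q W → R₂ ≤ jointInfo (jointLaw P Q) →
        jointInfo (jointLaw P Q) ≤ R₁ →
        -R₂ ≤ jointDiv W (jointLaw P Q) - jointInfo (jointLaw P Q) := by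
  rw [minDivSubInfo, ← EReal.coe_neg]
  simp only [le_iInf_iff]
  refine forall_congr' fun Q => ⟨fun h hQ hD hI hI' => ?_, fun h hQ => ?_⟩
  · have := h ⟨hQ, by rwa [mutualInfo_eq hP hQ], by rwa [mutualInfo_eq hP hQ]⟩
    rwa [divSubInfo_eq hP hQ hD, EReal.coe_le_coe_iff] at this
  · by_cases hD : DominatedOn P Q W
    · rw [divSubInfo_eq hP hQ.1 hD, EReal.coe_le_coe_iff]
      have := mutualInfo_eq hP hQ.1
      exact h hQ.1 hD (this ▸ hQ.2.1) (this ▸ hQ.2.2)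
    · rw [divSubInfo_eq_top hD]; exact le_top

/-- The rate term equals `0`, `R₁ - I` or `R₁ - R₂` according as `I ≥ R₁`, `R₂ ≤ I ≤ R₁` or `I ≤
R₂`. The first two ranges give the two conditions, and the third holds by `D ≥ 0`. -/
theorem exponentValue_eq_sub_iff (hP : ∀ a, 0 ≤ P a) (hW : IsChannel W) (h12 : R₂ ≤ R₁) :
    exponentValue P W R₁ R₂ = R₁ - R₂ ↔
      (R₁ : EReal) - E3 P W R₁ ≤ (R₂ : EReal) ∧ -(R₂ : EReal) ≤ minDivSubInfo P W R₁ R₂ := by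
  rw [sub_E3_le_iff hP, neg_le_minDivSubInfo_iff hP]
  constructor
  · intro h
    have key : ∀ Q, IsChannel Q → DominatedOn P Q W →
        R₁ - R₂ ≤ objective W (jointLaw P Q) R₁ R₂ := fun Q hQ hD => by
      obtain ⟨Q', hQ', he⟩ := exists_dominatedChannels_jointLaw_eq hW hQ hD
      rw [← h, ← he]
      exact exponentValue_le hQ' _ _
    refine ⟨fun Q hQ hD hI => ?_, fun Q hQ hD hI hI' => ?_⟩
    · have h1 := key Q hQ hD
      unfold objective at h1
      rw [max_eq_left (by linarith), min_eq_right (by linarith)] at h1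
      linarith
    · have h1 := key Q hQ hD
      unfold objective at h1
      rw [max_eq_right (by linarith), min_eq_right (by linarith)] at h1
      linarith
  · rintro ⟨h1, h2⟩
    refine le_antisymm ?_ ?_
    · refine (exponentValue_le (self_mem_dominatedChannels hW) _ _).trans ?_
      unfold objective
      rw [jointDiv_self hW, zero_add]
      exact min_le_left _ _
    · obtain ⟨Q, hQ, he⟩ := exists_eq_exponentValue hW P R₁ R₂
      rw [← he]
      have hD : DominatedOn P Q W := dominatedOn_of_mem hQ
      have h0 := jointDiv_nonneg hP hW hQ.1 hD
      unfold objective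
      rcases le_total R₁ (jointInfo (jointLaw P Q)) with hI | hI
      · have := h1 Q hQ.1 hD hI
        rw [max_eq_left (by linarith), min_eq_right (by linarith)]
        linarith
      · rcases le_total R₂ (jointInfo (jointLaw P Q)) with hI' | hI'
        · have := h2 Q hQ.1 hD hI' hI
          rw [max_eq_right (by linarith), min_eq_right (by linarith)]
          linarith
        · rw [max_eq_right (by linarith), min_eq_left (by linarith)]
          linarith

/-- Compactness gives a minimizer among dominated channels; a channel not dominated on the support
of `P` has value `⊤`. -/
theorem exists_isUnconstrainedMinimizer (hP : ∀ a, 0 ≤ P a) (hW : IsChannel W) :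
    ∃ Q, IsUnconstrainedMinimizer P W Q := by
  have hcont : Continuous fun Q : X → Z → ℝ =>
      jointDiv W (jointLaw P Q) - jointInfo (jointLaw P Q) := by
    have h : Continuous fun Q : X → Z → ℝ => jointLaw P Q := by
      unfold jointLaw
      fun_prop
    fun_prop
  obtain ⟨Q, hQ, hmin⟩ := (isCompact_dominatedChannels (W := W)).exists_isMinOn
    ⟨W, self_mem_dominatedChannels hW⟩ hcont.continuousOn
  refine ⟨Q, hQ.1, fun Q' hQ' => ?_⟩
  by_cases hD : DominatedOn P Q' W
  · obtain ⟨Q'', hQ'', he⟩ := exists_dominatedChannels_jointLaw_eq hW hQ' hD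
    rw [divSubInfo_eq hP hQ.1 (dominatedOn_of_mem hQ), divSubInfo_eq hP hQ' hD,
      EReal.coe_le_coe_iff, ← he]
    exact hmin hQ''
  · rw [divSubInfo_eq_top hD]; exact le_top

theorem IsUnconstrainedMinimizer.dominatedOn {Q : X → Z → ℝ} (hP : ∀ a, 0 ≤ P a)
    (hW : IsChannel W) (h : IsUnconstrainedMinimizer P W Q) : DominatedOn P Q W := by
  by_contra hD
  have := h.2 W hW
  rw [divSubInfo_eq_top hD, divSubInfo_eq hP hW fun _ _ _ => id, top_le_iff] at this
  exact EReal.coe_ne_top _ this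

theorem IsUnconstrainedMinimizer.le {Q Q' : X → Z → ℝ} (hP : ∀ a, 0 ≤ P a)
    (hW : IsChannel W) (h : IsUnconstrainedMinimizer P W Q) (hQ' : IsChannel Q')
    (hD : DominatedOn P Q' W) :
    jointDiv W (jointLaw P Q) - jointInfo (jointLaw P Q)
      ≤ jointDiv W (jointLaw P Q') - jointInfo (jointLaw P Q') := by
  have := h.2 Q' hQ'
  rwa [divSubInfo_eq hP h.1 (h.dominatedOn hP hW), divSubInfo_eq hP hQ' hD,
    EReal.coe_le_coe_iff] at this

/-- If `I(Q') ≥ R₁`, minimality gives `D(Q') ≥ I(Q') + D(Q) - I(Q) ≥ R₁ - I(Q)`, because `D(Q) ≥ 0`.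
-/
theorem IsUnconstrainedMinimizer.max_le {Q : X → Z → ℝ} (hP : ∀ a, 0 ≤ P a)
    (hW : IsChannel W) (h : IsUnconstrainedMinimizer P W Q) :
    max ((mutualInfo P Q : EReal) - condDiv P Q W) ((R₁ : EReal) - E3 P W R₁)
      ≤ (mutualInfo P Q : EReal) := by
  have hD := h.dominatedOn hP hW
  have h0 := jointDiv_nonneg hP hW h.1 hD
  refine _root_.max_le ?_ ?_
  · rw [condDiv_eq h.1 hD, ← EReal.coe_sub, EReal.coe_le_coe_iff]
    linarith
  · rw [sub_E3_le_iff hP, mutualInfo_eq hP h.1]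
    intro Q' hQ' hD' hI
    have := h.le hP hW hQ' hD'
    linarith

/-- The bound `D - I ≥ -R₂` at the global minimizer gives it for all channels. Comparison with `W`
gives `R₂ ≥ I(Q) - D(Q) ≥ I(W) ≥ 0`. -/
theorem IsUnconstrainedMinimizer.exponentValue_eq {Q : X → Z → ℝ} (hP : P ∈ stdSimplex ℝ X)
    (hW : IsChannel W) (h : IsUnconstrainedMinimizer P W Q) (hR₁ : mutualInfo P Q < R₁)
    (hR₂ : max ((mutualInfo P Q : EReal) - condDiv P Q W) ((R₁ : EReal) - E3 P W R₁)
      ≤ (R₂ : EReal)) (hR₂' : R₂ ≤ mutualInfo P Q) :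
    0 ≤ R₂ ∧ R₂ < R₁ ∧ exponentValue P W R₁ R₂ = R₁ - R₂ := by
  have hD := h.dominatedOn hP.1 hW
  obtain ⟨h1, h2⟩ := max_le_iff.1 hR₂
  rw [condDiv_eq h.1 hD, ← EReal.coe_sub, EReal.coe_le_coe_iff, mutualInfo_eq hP.1 h.1] at h1
  refine ⟨?_, by linarith, (exponentValue_eq_sub_iff hP.1 hW (by linarith)).2 ⟨h2, ?_⟩⟩
  · have h3 := h.le hP.1 hW hW fun _ _ _ => id
    rw [jointDiv_self hW, ← mutualInfo_eq hP.1 hW] at h3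
    linarith [mutualInfo_nonneg hP hW]
  · rw [neg_le_minDivSubInfo_iff hP.1]
    intro Q' hQ' hD' _ _
    have := h.le hP.1 hW hQ' hD'
    linarith

theorem exponent_eq_exponentValue [DecidableEq X] (hP : P ∈ stdSimplex ℝ X) (hW : IsChannel W)
    (h2 : 0 ≤ R₂) (h12 : R₂ ≤ R₁) : exponent P W R₁ R₂ = exponentValue P W R₁ R₂ :=
  have := regime_neBot hP h2 h12
  (tendsto_normalizedExponent hW).limUnder_eq

end Characterization

end Wiretap

end

theorem mainTheorem2 {X Z : Type*} [Fintype X] [DecidableEq X] [Fintype Z]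
    (P : X → ℝ) (hP : P ∈ stdSimplex ℝ X) (W : X → Z → ℝ) (hW : Wiretap.IsChannel W) :
    -- the limit defining the exponent exists, and full security is characterized
    (∀ R₁ R₂ : ℝ, 0 ≤ R₂ → R₂ ≤ R₁ →
      (Wiretap.regime P R₁ R₂).NeBot ∧
      Tendsto (Wiretap.normalizedExponent W) (Wiretap.regime P R₁ R₂)
        (𝓝 (Wiretap.exponent P W R₁ R₂)) ∧
      (Wiretap.exponent P W R₁ R₂ = R₁ - R₂ ↔
        (R₁ : EReal) - Wiretap.E3 P W R₁ ≤ (R₂ : EReal) ∧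
        -(R₂ : EReal) ≤ Wiretap.minDivSubInfo P W R₁ R₂)) ∧
    -- the region contains nontrivial pairs, with a positive exponent
    (∃ R₁ R₂ : ℝ, 0 ≤ R₂ ∧ R₂ < R₁ ∧ Wiretap.exponent P W R₁ R₂ = R₁ - R₂ ∧
      0 < Wiretap.exponent P W R₁ R₂) ∧
    -- the explicit construction of such pairs
    (∃ Qs : X → Z → ℝ, Wiretap.IsUnconstrainedMinimizer P W Qs) ∧
    (∀ Qs : X → Z → ℝ, Wiretap.IsUnconstrainedMinimizer P W Qs →
      ∀ R₁ : ℝ, Wiretap.mutualInfo P Qs < R₁ →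
        max ((Wiretap.mutualInfo P Qs : EReal) - Wiretap.condDiv P Qs W)
            ((R₁ : EReal) - Wiretap.E3 P W R₁) ≤ (Wiretap.mutualInfo P Qs : EReal) ∧
        ∀ R₂ : ℝ,
          max ((Wiretap.mutualInfo P Qs : EReal) - Wiretap.condDiv P Qs W)
              ((R₁ : EReal) - Wiretap.E3 P W R₁) ≤ (R₂ : EReal) →
          R₂ ≤ Wiretap.mutualInfo P Qs →
            0 ≤ R₂ ∧ R₂ < R₁ ∧
            Wiretap.exponent P W R₁ R₂ = R₁ - R₂ ∧ 0 < Wiretap.exponent P W R₁ R₂) := by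

  have hmin : ∀ Qs : X → Z → ℝ, Wiretap.IsUnconstrainedMinimizer P W Qs →
      ∀ R₁ : ℝ, Wiretap.mutualInfo P Qs < R₁ → ∀ R₂ : ℝ,
        max ((Wiretap.mutualInfo P Qs : EReal) - Wiretap.condDiv P Qs W)
            ((R₁ : EReal) - Wiretap.E3 P W R₁) ≤ (R₂ : EReal) →
        R₂ ≤ Wiretap.mutualInfo P Qs →
          0 ≤ R₂ ∧ R₂ < R₁ ∧
          Wiretap.exponent P W R₁ R₂ = R₁ - R₂ ∧ 0 < Wiretap.exponent P W R₁ R₂ := by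
    intro Qs hQs R₁ hR₁ R₂ h1 h2
    obtain ⟨h3, h4, h5⟩ := hQs.exponentValue_eq hP hW hR₁ h1 h2
    rw [← Wiretap.exponent_eq_exponentValue hP hW h3 h4.le] at h5
    exact ⟨h3, h4, h5, by rw [h5]; linarith⟩
  obtain ⟨Q, hQ⟩ := Wiretap.exists_isUnconstrainedMinimizer hP.1 hW
  refine ⟨fun R₁ R₂ h2 h12 => ⟨Wiretap.regime_neBot hP h2 h12, ?_, ?_⟩, ?_, ⟨Q, hQ⟩,
    fun Qs hQs R₁ hR₁ => ⟨hQs.max_le hP.1 hW, hmin Qs hQs R₁ hR₁⟩⟩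
  · rw [Wiretap.exponent_eq_exponentValue hP hW h2 h12]
    exact Wiretap.tendsto_normalizedExponent hW
  · rw [Wiretap.exponent_eq_exponentValue hP hW h2 h12]
    exact Wiretap.exponentValue_eq_sub_iff hP.1 hW h12
  -- `R₂ = I(Q)` is the right end of the admissible interval, nonempty by `max_le`; any `R₁ > I(Q)`
  -- would do.
  · exact ⟨Wiretap.mutualInfo P Q + 1, Wiretap.mutualInfo P Q,
      hmin Q hQ _ (lt_add_one _) _ (hQ.max_le hP.1 hW) le_rfl⟩
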